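/- Let $a,b>0$ be constants, let $V:\mathbb R^3\to\mathbb R$ and $f:\mathbb R^3\times\mathbb R\to\mathbb R$, and put $V^+=\max\{V,0\}$ and $F(x,t)=\int_0^t f(x,s)\,ds$. Assume: - $(V_1)$ $V$ is continuous and bounded from below, and there is $M>0$ such that $\{x\in\mathbb R^3: V^+(x)<M\}$ is nonempty and has finite Lebesgue measure. - $(f_1)$ $f\in C^1(\mathbb R^3\times\mathbb R,\mathbb R)$, and there are $p\in(2,6)$ and $c>0$ with $|f(x,t)|\le c(1+|t|^{p-1})$ for all $(x,t)\in\mathbb R^3\times\mathbb R$. - $(f_2)$ $f(x,t)=o(t)$ as $t\to0$, uniformly in $x\in\mathbb R^3$, and for every $x\in\mathbb R^3$, $F(x,t)/t^4\to+\infty$ as $|t|\to\infty$. - $(f_3)$ There are $a_0,b_0>0$ and $\alpha\in(0,\alpha_*)$, where $\alpha_*=\min\{p',5p'-6\}$ and $\frac1p+\frac1{p'}=1$ with $p$ as in $(f_1)$, such that for all $x\in\mathbb R^3$ and $t\neq0$, $$0<\Bigl(4+\frac{1}{a_0|t|^{\alpha}+b_0}\Bigr)F(x,t)\le t f(x,t).$$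 - $(f_4)$ For every $l>0$, $\displaystyle\lim_{|x|\to\infty}\ \sup_{0<|t|\le l}\frac{|f(x,t)|}{|t|}=0$. Let $$E=\Bigl\{u\in H^1(\mathbb R^3):\int_{\mathbb R^3}\bigl(a|\nabla u|^2+V^+u^2\bigr)\,dx<\infty\Bigr\},\qquad \langle u,v\rangle=\int_{\mathbb R^3}\bigl(a\nabla u\cdot\nabla v+V^+uv\bigr)\,dx,\qquad \|u\|=\langle u,u\rangle^{1/2},$$ and let $\Phi:E\to\mathbb R$ be given by $$\Phi(u)=\frac12\int_{\mathbb R^3}\bigl(a|\nabla u|^2+Vu^2\bigr)\,dx+\frac b4\Bigl(\int_{\mathbb R^3}|\nabla u|^2\,dx\Bigr)^2-\int_{\mathbb R^3}F(x,u)\,dx .$$ Then $\Phi\in C^1(E,\mathbb R)$, and $\Phi$ satisfies the Cerami condition at every level $c\in\mathbb R$: every sequence $(u_n)$ in $E$ with $\Phi(u_n)\to c$ and $(1+\|u_n\|)\,\|\Phi'(u_n)\|_{E^*}\to0$ has a subsequence that converges in the norm of $E$. -/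

import Mathlib

open MeasureTheory Filter Topology
open scoped ContDiff ENNReal

noncomputable section

namespace Kirchhoff

/-- Euclidean space `ℝ³`. -/
abbrev R3 : Type := EuclideanSpace ℝ (Fin 3)

/-- `G` is the weak gradient of `u` on `ℝ³`: for all smooth compactly supported `φ` and all
directions `v`, `∫ u ∂ᵥφ = - ∫ φ (G · v)`. -/
def IsWeakGradient (u : R3 → ℝ) (G : R3 → R3) : Prop :=
  ∀ φ : R3 → ℝ, ContDiff ℝ ∞ φ → HasCompactSupport φ → ∀ v : R3,
    ∫ x, u x * fderiv ℝ φ x v = - ∫ x, φ x * inner ℝ (G x) v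

lemma memLp_mul_integrable {u g : R3 → ℝ} (hu : MemLp u 2 volume) (hg : MemLp g 2 volume) :
    Integrable (fun x => u x * g x) := hu.integrable_mul hg

lemma memLp_test {φ : R3 → ℝ} (h : Continuous φ) (hc : HasCompactSupport φ) :
    MemLp φ 2 volume := h.memLp_of_hasCompactSupport hc

lemma memLp_test_fderiv {φ : R3 → ℝ} (h : ContDiff ℝ ∞ φ) (hc : HasCompactSupport φ) (v : R3) :
    MemLp (fun x => fderiv ℝ φ x v) 2 volume :=
  memLp_test ((h.continuous_fderiv (by simp)).clm_apply continuous_const)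
    (hc.fderiv_apply (𝕜 := ℝ) v)

lemma memLp_inner_const {G : R3 → R3} (h : MemLp G 2 volume) (v : R3) :
    MemLp (fun x => inner ℝ (G x) v) 2 volume := h.inner_const v

lemma IsWeakGradient.congr {u u' : R3 → ℝ} {G G' : R3 → R3} (h : IsWeakGradient u G)
    (hu : u' =ᵐ[volume] u) (hG : G' =ᵐ[volume] G) : IsWeakGradient u' G' := by
  intro φ hφ hc v
  have h1 : ∫ x, u' x * fderiv ℝ φ x v = ∫ x, u x * fderiv ℝ φ x v :=
    integral_congr_ae (by filter_upwards [hu] with x hx; rw [hx])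
  have h2 : ∫ x, φ x * inner ℝ (G' x) v = ∫ x, φ x * inner ℝ (G x) v :=
    integral_congr_ae (by filter_upwards [hG] with x hx; rw [hx])
  rw [h1, h2, h φ hφ hc v]

/-- The Sobolev space `H¹(ℝ³)`: pairs `(u, ∇u)` in `L² × L²` whose second component is the weak
gradient of the first (which determines it). -/
def sobolevH1 : Submodule ℝ (Lp ℝ 2 (volume : Measure R3) × Lp R3 2 (volume : Measure R3)) where
  carrier := {w | IsWeakGradient w.1 w.2}
  zero_mem' := by
    refine IsWeakGradient.congr (u := fun _ => 0) (G := fun _ => 0) ?_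
      (Lp.coeFn_zero _ _ _) (Lp.coeFn_zero _ _ _)
    intro φ _ _ v
    simp
  add_mem' := by
    intro w z hw hz
    refine IsWeakGradient.congr (u := fun x => w.1 x + z.1 x) (G := fun x => w.2 x + z.2 x) ?_
      (Lp.coeFn_add _ _) (Lp.coeFn_add _ _)
    intro φ hφ hc v
    have a1 := memLp_mul_integrable (Lp.memLp w.1) (memLp_test_fderiv hφ hc v)
    have a2 := memLp_mul_integrable (Lp.memLp z.1) (memLp_test_fderiv hφ hc v)
    have b1 := memLp_mul_integrable (memLp_test hφ.continuous hc)
      (memLp_inner_const (Lp.memLp w.2) v)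
    have b2 := memLp_mul_integrable (memLp_test hφ.continuous hc)
      (memLp_inner_const (Lp.memLp z.2) v)
    simp only [add_mul, inner_add_left, mul_add]
    rw [integral_add a1 a2, integral_add b1 b2, hw φ hφ hc v, hz φ hφ hc v]
    ring
  smul_mem' := by
    intro c w hw
    refine IsWeakGradient.congr (u := fun x => c * w.1 x) (G := fun x => c • w.2 x) ?_
      (Lp.coeFn_smul _ _) (Lp.coeFn_smul _ _)
    intro φ hφ hc v
    simp only [mul_assoc, real_inner_smul_left, mul_left_comm _ c, integral_const_mul]
    rw [hw φ hφ hc v]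
    ring

/-- An `L²` function on `ℝ³` with vanishing weak gradient is zero. -/
lemma ae_eq_zero_of_weakGradient_zero {u : R3 → ℝ} (hu : MemLp u 2 volume)
    (h : IsWeakGradient u (fun _ => 0)) : u =ᵐ[volume] 0 := by
  have hloc : LocallyIntegrable u volume := hu.locallyIntegrable (by norm_num)
  refine ae_eq_zero_of_integral_contDiff_smul_eq_zero hloc ?_
  intro g hg hc
  -- `s ↦ ∫ u(t) g(t - s) dt` is constant
  let g' : R3 → ℝ := fun x => g (-x)
  have hg' : ContDiff ℝ ∞ g' := hg.comp contDiff_neg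
  have hc' : HasCompactSupport g' := hc.comp_homeomorph (Homeomorph.neg R3)
  let L := ContinuousLinearMap.mul ℝ ℝ
  have hder : ∀ x, fderiv ℝ (convolution u g' L volume) x = 0 := by
    intro x
    have h1 := (hc'.hasFDerivAt_convolution_right L hloc (hg'.of_le (by simp)) x).fderiv
    rw [h1]
    have hex : ConvolutionExistsAt u (fderiv ℝ g') x (L.precompR R3) volume :=
      (hc'.fderiv (𝕜 := ℝ)).convolutionExists_right _ hloc (hg'.continuous_fderiv (by simp)) x
    ext v
    rw [convolution_def, ContinuousLinearMap.integral_apply hex]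
    have hφ : ContDiff ℝ ∞ (fun t => g' (x - t)) := hg'.comp (contDiff_const.sub contDiff_id)
    have hφc : HasCompactSupport (fun t => g' (x - t)) :=
      hc'.comp_homeomorph (Homeomorph.subLeft x)
    have h2 := h _ hφ hφc v
    simp only [inner_zero_left, mul_zero, integral_zero, neg_zero] at h2
    have h3 : ∀ t, fderiv ℝ (fun t => g' (x - t)) t v = - fderiv ℝ g' (x - t) v := by
      intro t
      have := ((hg'.differentiable (by simp)) (x - t)).hasFDerivAt.comp t
        ((hasFDerivAt_const x t).sub (hasFDerivAt_id t))
      have e := this.fderiv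
      simp only [Function.comp_def] at e
      change fderiv ℝ (fun t => g' (x - t)) t = _ at e
      rw [e]; simp
    simp only [h3, mul_neg, integral_neg, neg_eq_zero] at h2
    simpa [L, ContinuousLinearMap.precompR_apply] using h2
  have hdiff : Differentiable ℝ (convolution u g' L volume) := fun x =>
    (hc'.hasFDerivAt_convolution_right L hloc (hg'.of_le (by simp)) x).differentiableAt
  have hconst : ∀ x, ∫ t, g t * u t = ∫ t, u t * g' (x - t) := by
    intro x
    have h1 := is_const_of_fderiv_eq_zero hdiff hder 0 x
    have h2 : convolution u g' L volume 0 = ∫ t, g t * u t := by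
      rw [convolution_def]; congr 1; ext t; simp [L, g', mul_comm]
    rw [← h2, h1, convolution_def]; rfl
  -- far away it is small
  obtain ⟨R, hR⟩ := hc'.isCompact.isBounded.subset_closedBall 0
  have hg2 : Integrable (fun t => g' t ^ 2) := (memLp_test hg'.continuous hc').integrable_sq
  have hu2 : Integrable (fun t => u t ^ 2) := hu.integrable_sq
  let S : ℕ → Set R3 := fun n => {t | (n : ℝ) ≤ ‖t‖}
  have hS : ∀ n, MeasurableSet (S n) := fun n =>
    (isClosed_le continuous_const continuous_norm).measurableSet
  have htend : Tendsto (fun n => ∫ t in S n, u t ^ 2) atTop (𝓝 0) := by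
    have := tendsto_setIntegral_of_antitone (μ := volume) (f := fun t => u t ^ 2) (s := S) hS
      (fun m n hmn t (ht : (n : ℝ) ≤ ‖t‖) =>
        show (m : ℝ) ≤ ‖t‖ from le_trans (Nat.cast_le.2 hmn) ht) ⟨0, hu2.integrableOn⟩
    have he : (⋂ n, S n) = ∅ := by
      ext t
      simp only [S, Set.mem_iInter, Set.mem_ofPred_eq, Set.mem_empty_iff_false, iff_false,
        not_forall, not_le]
      exact exists_nat_gt _
    simpa [he] using this
  have key : ∀ l : ℝ, 0 < l → |∫ t, g t * u t| ≤ l * ∫ t, g' t ^ 2 := by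
    intro l hl
    have hn : ∀ n : ℕ, |∫ t, g t * u t| ≤ l * (∫ t, g' t ^ 2) + l⁻¹ * ∫ t in S n, u t ^ 2 := by
      intro n
      let x : R3 := EuclideanSpace.single 0 ((n : ℝ) + |R|)
      have hx : ‖x‖ = n + |R| := by
        simp only [x, PiLp.norm_single, EuclideanSpace.single, Real.norm_eq_abs]
        exact abs_of_nonneg (by positivity)
      have hgx : Integrable (fun t => g' (x - t) ^ 2) := hg2.comp_sub_left x
      have hint : ∫ t, g' (x - t) ^ 2 = ∫ t, g' t ^ 2 :=
        integral_sub_left_eq_self (fun t => g' t ^ 2) volume x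
      rw [hconst x, ← hint, ← integral_const_mul, ← integral_const_mul,
        ← integral_indicator (hS n), ← integral_add (hgx.const_mul l)
          ((hu2.const_mul _).indicator (hS n)), ← Real.norm_eq_abs]
      refine norm_integral_le_of_norm_le ((hgx.const_mul l).add
          ((hu2.const_mul _).indicator (hS n))) (Eventually.of_forall fun t => ?_)
      rw [Real.norm_eq_abs]
      by_cases ht : t ∈ S n
      · simp only [Set.indicator_of_mem ht]
        have h1 : l * l⁻¹ = 1 := mul_inv_cancel₀ hl.ne'
        have h2 : 0 < l⁻¹ := inv_pos.2 hl
        have h3 : 0 ≤ l⁻¹ * (|u t| - l * |g' (x - t)|) ^ 2 := by positivity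
        have h4 : l⁻¹ * (|u t| - l * |g' (x - t)|) ^ 2
            = l⁻¹ * u t ^ 2 - 2 * (l * l⁻¹) * (|u t| * |g' (x - t)|)
              + (l * l⁻¹) * l * g' (x - t) ^ 2 := by
          rw [← sq_abs (u t), ← sq_abs (g' (x - t))]; ring
        rw [h1] at h4
        rw [abs_mul]
        nlinarith [abs_nonneg (u t), abs_nonneg (g' (x - t)),
          mul_nonneg (abs_nonneg (u t)) (abs_nonneg (g' (x - t)))]
      · have h0 : g' (x - t) = 0 := by
          by_contra hne
          have hm := hR (subset_tsupport g' hne)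
          rw [mem_closedBall_zero_iff] at hm
          apply ht
          have h5 := norm_sub_norm_le x t
          have h6 := le_abs_self R
          simp only [S, Set.mem_ofPred_eq]
          linarith
        simp [h0, Set.indicator_of_notMem ht]
    have hlim : Tendsto (fun n : ℕ => l * (∫ t, g' t ^ 2) + l⁻¹ * ∫ t in S n, u t ^ 2) atTop
        (𝓝 (l * (∫ t, g' t ^ 2) + l⁻¹ * 0)) := (htend.const_mul _).const_add _
    simpa using ge_of_tendsto' hlim hn
  have hzero : |∫ t, g t * u t| ≤ 0 := by
    have hlim : Tendsto (fun l : ℝ => l * ∫ t, g' t ^ 2) (𝓝[>] 0) (𝓝 (0 * ∫ t, g' t ^ 2)) :=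
      ((continuous_id.mul continuous_const).tendsto 0).mono_left nhdsWithin_le_nhds
    rw [zero_mul] at hlim
    exact ge_of_tendsto hlim (eventually_nhdsWithin_of_forall fun l hl => key l hl)
  simpa using abs_nonpos_iff.1 hzero

/-- The positive part `V⁺ = max (V, 0)`. -/
def posPart (V : R3 → ℝ) (x : R3) : ℝ := max (V x) 0

lemma posPart_nonneg (V : R3 → ℝ) (x : R3) : 0 ≤ posPart V x := le_max_right _ _

lemma continuous_posPart (V : C(R3, ℝ)) : Continuous (posPart V) :=
  V.continuous.max continuous_const

lemma integrable_grad_mul (w z : Lp R3 2 (volume : Measure R3)) :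
    Integrable (fun x => inner ℝ (w x) (z x)) :=
  L2.integrable_inner (𝕜 := ℝ) w z

lemma integrable_grad_sq (w : Lp R3 2 (volume : Measure R3)) :
    Integrable (fun x => ‖w x‖ ^ 2) := by
  simpa only [real_inner_self_eq_norm_sq] using integrable_grad_mul w w

lemma integrable_energy_iff (a : ℝ) (V : R3 → ℝ)
    (w : Lp ℝ 2 (volume : Measure R3) × Lp R3 2 (volume : Measure R3)) :
    Integrable (fun x => a * ‖w.2 x‖ ^ 2 + posPart V x * w.1 x ^ 2) ↔
      Integrable (fun x => posPart V x * w.1 x ^ 2) :=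
  integrable_add_iff_integrable_right' ((integrable_grad_sq w.2).const_mul a)

lemma integrable_posPart_mul (V : C(R3, ℝ)) {u v : R3 → ℝ}
    (hu : MemLp u 2 volume) (hv : MemLp v 2 volume)
    (h1 : Integrable (fun x => posPart V x * u x ^ 2))
    (h2 : Integrable (fun x => posPart V x * v x ^ 2)) :
    Integrable (fun x => posPart V x * (u x * v x)) := by
  refine (h1.add h2).mono' ((continuous_posPart V).aestronglyMeasurable.mul
    (hu.1.mul hv.1)) (Eventually.of_forall fun x => ?_)
  have hp := posPart_nonneg V x
  rw [Real.norm_eq_abs, abs_mul, abs_of_nonneg hp, Pi.add_apply, ← mul_add]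
  refine mul_le_mul_of_nonneg_left ?_ hp
  rw [abs_le]
  constructor <;> nlinarith [sq_nonneg (u x + v x), sq_nonneg (u x - v x)]

/-- The vector space `{u ∈ H¹(ℝ³) : ∫ (a |∇u|² + V⁺ u²) < ∞}`. -/
def energySubmodule (a : ℝ) (V : C(R3, ℝ)) :
    Submodule ℝ (Lp ℝ 2 (volume : Measure R3) × Lp R3 2 (volume : Measure R3)) where
  carrier := {w | w ∈ sobolevH1 ∧
    Integrable (fun x => a * ‖w.2 x‖ ^ 2 + posPart V x * w.1 x ^ 2)}
  zero_mem' := by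
    refine ⟨sobolevH1.zero_mem, (integrable_energy_iff a V 0).2 ?_⟩
    refine (integrable_zero R3 ℝ volume).congr ?_
    filter_upwards [Lp.coeFn_zero ℝ 2 (volume : Measure R3)] with x hx
    simp
  add_mem' := by
    rintro w z ⟨hw, hw'⟩ ⟨hz, hz'⟩
    rw [integrable_energy_iff] at hw' hz'
    refine ⟨sobolevH1.add_mem hw hz, (integrable_energy_iff a V _).2 ?_⟩
    refine ((hw'.add hz').add ((integrable_posPart_mul V (Lp.memLp w.1) (Lp.memLp z.1)
      hw' hz').const_mul 2)).congr ?_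
    filter_upwards [Lp.coeFn_add w.1 z.1] with x hx
    simp only [Prod.fst_add, hx, Pi.add_apply]
    ring
  smul_mem' := by
    rintro c w ⟨hw, hw'⟩
    rw [integrable_energy_iff] at hw'
    refine ⟨sobolevH1.smul_mem c hw, (integrable_energy_iff a V _).2 ?_⟩
    refine (hw'.const_mul (c ^ 2)).congr ?_
    filter_upwards [Lp.coeFn_smul c w.1] with x hx
    simp only [Prod.smul_fst, hx, Pi.smul_apply, smul_eq_mul]
    ring

/-- The space `E` of the Kirchhoff problem, to be normed by
`‖u‖² = ∫ (a |∇u|² + V⁺ u²)`, where `a > 0`. -/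
def EnergySpace (a : ℝ) (_ha : 0 < a) (V : C(R3, ℝ)) : Type := energySubmodule a V

namespace EnergySpace

variable {a : ℝ} {ha : 0 < a} {V : C(R3, ℝ)}

instance : AddCommGroup (EnergySpace a ha V) :=
  inferInstanceAs (AddCommGroup (energySubmodule a V))

instance : Module ℝ (EnergySpace a ha V) :=
  inferInstanceAs (Module ℝ (energySubmodule a V))

/-- The underlying function `u` of an element of `E`. -/
def fn (u : EnergySpace a ha V) : Lp ℝ 2 (volume : Measure R3) := u.1.1

/-- The weak gradient `∇u` of an element of `E`. -/
def grad (u : EnergySpace a ha V) : Lp R3 2 (volume : Measure R3) := u.1.2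

lemma integrable_pot (u : EnergySpace a ha V) :
    Integrable (fun x => posPart V x * u.fn x ^ 2) :=
  (integrable_energy_iff a V u.1).1 u.2.2

lemma integrable_pot_mul (u v : EnergySpace a ha V) :
    Integrable (fun x => posPart V x * (u.fn x * v.fn x)) :=
  integrable_posPart_mul V (Lp.memLp _) (Lp.memLp _) u.integrable_pot v.integrable_pot

lemma integrable_inner (u v : EnergySpace a ha V) :
    Integrable (fun x => a * inner ℝ (u.grad x) (v.grad x)
      + posPart V x * (u.fn x * v.fn x)) :=
  ((integrable_grad_mul _ _).const_mul a).add (integrable_pot_mul u v)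

/-- The inner product `⟨u, v⟩ = ∫ (a ∇u · ∇v + V⁺ u v)` on `E`. -/
@[reducible]
def core : InnerProductSpace.Core ℝ (EnergySpace a ha V) where
  inner u v := ∫ x, (a * inner ℝ (u.grad x) (v.grad x) + posPart V x * (u.fn x * v.fn x))
  conj_inner_symm u v := by
    simp only [conj_trivial]
    congr 1
    ext x
    rw [real_inner_comm, mul_comm (v.fn x)]
  re_inner_nonneg u := by
    refine integral_nonneg fun x => add_nonneg (mul_nonneg ha.le real_inner_self_nonneg)
      (mul_nonneg (posPart_nonneg V x) (mul_self_nonneg _))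
  add_left u v w := by
    rw [← integral_add (integrable_inner u w) (integrable_inner v w)]
    refine integral_congr_ae ?_
    filter_upwards [Lp.coeFn_add u.fn v.fn, Lp.coeFn_add u.grad v.grad] with x h1 h2
    have h1' : (u + v).fn x = u.fn x + v.fn x := h1
    have h2' : (u + v).grad x = u.grad x + v.grad x := h2
    rw [h1', h2', inner_add_left]
    ring
  smul_left u v c := by
    simp only [conj_trivial]
    rw [← integral_const_mul]
    refine integral_congr_ae ?_
    filter_upwards [Lp.coeFn_smul c u.fn, Lp.coeFn_smul c u.grad] with x h1 h2
    have h1' : (c • u).fn x = c * u.fn x := h1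
    have h2' : (c • u).grad x = c • u.grad x := h2
    rw [h1', h2', real_inner_smul_left]
    ring
  definite u hu := by
    have hnn : ∀ x, 0 ≤ a * inner ℝ (u.grad x) (u.grad x) + posPart V x * (u.fn x * u.fn x) :=
      fun x => add_nonneg (mul_nonneg ha.le real_inner_self_nonneg)
        (mul_nonneg (posPart_nonneg V x) (mul_self_nonneg _))
    have h0 := (integral_eq_zero_iff_of_nonneg hnn (integrable_inner u u)).1 hu
    have hg : (u.grad : R3 → R3) =ᵐ[volume] fun _ => 0 := by
      filter_upwards [h0] with x hx
      have h1 : 0 ≤ posPart V x * (u.fn x * u.fn x) :=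
        mul_nonneg (posPart_nonneg V x) (mul_self_nonneg _)
      have h2 : 0 ≤ inner ℝ (u.grad x) (u.grad x) := real_inner_self_nonneg
      have h3 : a * inner ℝ (u.grad x) (u.grad x) = 0 := by
        have h4 : a * inner ℝ (u.grad x) (u.grad x) + posPart V x * (u.fn x * u.fn x) = 0 := hx
        nlinarith [mul_nonneg ha.le h2]
      exact inner_self_eq_zero.1 ((mul_eq_zero.1 h3).resolve_left ha.ne')
    have hw : IsWeakGradient u.fn u.grad := u.2.1
    have hf : (u.fn : R3 → ℝ) =ᵐ[volume] 0 :=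
      ae_eq_zero_of_weakGradient_zero (Lp.memLp u.fn)
        (hw.congr EventuallyEq.rfl hg.symm)
    refine Subtype.ext (Prod.ext ?_ ?_)
    · exact (Lp.eq_zero_iff_ae_eq_zero (f := u.fn)).2 hf
    · exact (Lp.eq_zero_iff_ae_eq_zero (f := u.grad)).2 hg

instance : NormedAddCommGroup (EnergySpace a ha V) :=
  @InnerProductSpace.Core.toNormedAddCommGroup ℝ (EnergySpace a ha V) _ _ _ core

instance : InnerProductSpace ℝ (EnergySpace a ha V) :=
  InnerProductSpace.ofCore (core (a := a) (ha := ha) (V := V)).toCore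

lemma inner_def (u v : EnergySpace a ha V) :
    inner ℝ u v =
      ∫ x, (a * inner ℝ (u.grad x) (v.grad x) + posPart V x * (u.fn x * v.fn x)) := rfl

lemma norm_sq_def (u : EnergySpace a ha V) :
    ‖u‖ ^ 2 = ∫ x, (a * ‖u.grad x‖ ^ 2 + posPart V x * u.fn x ^ 2) := by
  rw [← real_inner_self_eq_norm_sq, inner_def]
  simp only [real_inner_self_eq_norm_sq, sq]

end EnergySpace

/-- The primitive `F(x, t) = ∫₀ᵗ f(x, s) ds`. -/
def primitive (f : R3 → ℝ → ℝ) (x : R3) (t : ℝ) : ℝ := ∫ s in (0 : ℝ)..t, f x s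

/-- The functional
`Φ(u) = ½ ∫ (a |∇u|² + V u²) + (b/4) (∫ |∇u|²)² - ∫ F(x, u)` on `E`. -/
def functional (a : ℝ) (ha : 0 < a) (b : ℝ) (V : C(R3, ℝ)) (f : R3 → ℝ → ℝ)
    (u : EnergySpace a ha V) : ℝ :=
  1 / 2 * (∫ x, (a * ‖u.grad x‖ ^ 2 + V x * u.fn x ^ 2))
    + b / 4 * (∫ x, ‖u.grad x‖ ^ 2) ^ 2
    - ∫ x, primitive f x (u.fn x)

/-- Condition (V1) on the (continuous) potential. -/
def CondV1 (V : C(R3, ℝ)) : Prop :=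
  (∃ m : ℝ, ∀ x, m ≤ V x) ∧
  ∃ M : ℝ, 0 < M ∧ {x | posPart V x < M}.Nonempty ∧ volume {x | posPart V x < M} < ⊤

/-- Condition (f1) with exponent `p`. -/
def CondF1 (f : R3 → ℝ → ℝ) (p : ℝ) : Prop :=
  ContDiff ℝ 1 (fun z : R3 × ℝ => f z.1 z.2) ∧ 2 < p ∧ p < 6 ∧
  ∃ c : ℝ, 0 < c ∧ ∀ x t, |f x t| ≤ c * (1 + |t| ^ (p - 1))

/-- Condition (f2): `f(x, t) = o(t)` as `t → 0` uniformly in `x`, and for each `x`,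
`F(x, t) / t⁴ → +∞` as `|t| → ∞`. -/
def CondF2 (f : R3 → ℝ → ℝ) : Prop :=
  (∀ ε : ℝ, 0 < ε → ∃ δ : ℝ, 0 < δ ∧ ∀ x t, |t| < δ → |f x t| ≤ ε * |t|) ∧
  ∀ x, Tendsto (fun t : ℝ => primitive f x t / t ^ 4) (cocompact ℝ) atTop

/-- The conjugate exponent `p' = p / (p - 1)`. -/
def conjExp (p : ℝ) : ℝ := p / (p - 1)

/-- Condition (f3), with `p` the exponent of (f1). -/
def CondF3 (f : R3 → ℝ → ℝ) (p : ℝ) : Prop :=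
  ∃ a₀ b₀ α : ℝ, 0 < a₀ ∧ 0 < b₀ ∧ 0 < α ∧ α < min (conjExp p) (5 * conjExp p - 6) ∧
    ∀ x t, t ≠ 0 →
      0 < (4 + 1 / (a₀ * |t| ^ α + b₀)) * primitive f x t ∧
      (4 + 1 / (a₀ * |t| ^ α + b₀)) * primitive f x t ≤ t * f x t

/-- Condition (f4): for every `l > 0`, `sup_{0 < |t| ≤ l} |f(x, t)| / |t| → 0` as `|x| → ∞`. -/
def CondF4 (f : R3 → ℝ → ℝ) : Prop :=
  ∀ l : ℝ, 0 < l → ∀ ε : ℝ, 0 < ε → ∃ R : ℝ, ∀ x, R ≤ ‖x‖ →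
    ∀ t, t ≠ 0 → |t| ≤ l → |f x t| / |t| ≤ ε

section Cerami

variable {X : Type*} [NormedAddCommGroup X] [NormedSpace ℝ X]

/-- `u` is a Cerami sequence of `Φ` at level `c`. -/
def IsCeramiSeq (Φ : X → ℝ) (c : ℝ) (u : ℕ → X) : Prop :=
  Tendsto (fun n => Φ (u n)) atTop (𝓝 c) ∧
  Tendsto (fun n => (1 + ‖u n‖) * ‖fderiv ℝ Φ (u n)‖) atTop (𝓝 0)

/-- The Cerami condition at level `c`: every Cerami sequence at level `c` has a subsequence
that converges in norm. -/
def CeramiConditionAt (Φ : X → ℝ) (c : ℝ) : Prop :=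
  ∀ u : ℕ → X, IsCeramiSeq Φ c u →
    ∃ (w : X) (k : ℕ → ℕ), StrictMono k ∧ Tendsto (fun n => u (k n)) atTop (𝓝 w)

end Cerami

end Kirchhoff

end

/-! With `V = V⁺ - V⁻`, the functional is `½‖u‖² - ½∫V⁻u² + (b/4)|∇u|₂⁴ - ∫F(x,u)`. The last term
and the `V⁻` term are compact perturbations, and the Kirchhoff term has a monotone derivative.

Embeddings: Sobolev's inequality bounds `u` in `L⁶`. Hölder turns this into an `L²` bound on the
finite-measure set `{V⁺ < M}`, and off that set `u² ≤ M⁻¹V⁺u²`. Sobolev's inequality and Rellich's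
theorem are derived from the weak gradient by mollification.

Compactness: `V⁻` is bounded and lives in `{V⁺ < M}`, whose part outside a large ball has small
measure; so up to `ε‖u‖²` the `V⁻` term is controlled by `∫u²` over a ball
(`exists_integral_negPart_le`). For `f` the same localization comes from (f4) at bounded `|t|` and
subcritical growth at large `|t|` (`exists_modulus`); this estimate also yields the `C¹` property.
Testing `Φ'(u) - Φ'(w)` with `u - w` then bounds `‖u - w‖²` by the two derivatives, a small error
and `∫(u - w)²` over a ball (`exists_norm_sub_sq_le`). By Rellich a bounded Cerami sequence has a
Cauchy subsequence, and `E` is complete.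

Boundedness along a subsequence: suppose `‖uₙ‖ → ∞` and let `v` be an `L²_loc` limit of `uₙ/‖uₙ‖`.
If `v = 0`, the inequality `4Φ(u) - Φ'(u)u ≥ ‖u‖² - ∫V⁻u²`, a consequence of `4F ≤ tf`, makes the
left side unbounded along `uₙ`. If `v ≠ 0`, superquartic growth of `F` and Fatou force
`∫F(x,uₙ)/‖uₙ‖⁴ → ∞`, whereas boundedness of `Φ(uₙ)` bounds this quotient. -/

noncomputable section

namespace Kirchhoff

/-! ### Weighted Cauchy–Schwarz and mollification in `L²`. -/

section

section LIntegral

variable {α : Type*} [MeasurableSpace α] {μ : Measure α}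

lemma eLpNorm_two_sq {ε : Type*} [ENorm ε] (g : α → ε) :
    eLpNorm g 2 μ ^ 2 = ∫⁻ x, ‖g x‖ₑ ^ 2 ∂μ := by
  rw [eLpNorm_eq_lintegral_rpow_enorm_toReal (by norm_num) (by norm_num), ← ENNReal.rpow_natCast,
    ← ENNReal.rpow_mul]
  simp

/-- Cauchy–Schwarz after splitting the weight as `ρ^(1/2) * ρ^(1/2)`: Jensen's inequality for the
probability density `ρ`. -/
lemma sq_lintegral_mul_le {ρ h : α → ℝ≥0∞} (hρ : AEMeasurable ρ μ) (hh : AEMeasurable h μ)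
    (h1 : ∫⁻ x, ρ x ∂μ = 1) : (∫⁻ x, ρ x * h x ∂μ) ^ 2 ≤ ∫⁻ x, ρ x * h x ^ 2 ∂μ := by
  have key := ENNReal.lintegral_mul_le_Lp_mul_Lq μ (p := 2) (q := 2)
    (Real.holderConjugate_iff.2 ⟨by norm_num, by norm_num⟩)
    (f := fun x => ρ x ^ (1 / 2 : ℝ)) (g := fun x => ρ x ^ (1 / 2 : ℝ) * h x)
    (hρ.pow_const _) ((hρ.pow_const _).mul hh)
  have e1 : ∀ x, ρ x ^ (1 / 2 : ℝ) * (ρ x ^ (1 / 2 : ℝ) * h x) = ρ x * h x := fun x => by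
    rw [← mul_assoc, ← ENNReal.rpow_add_of_nonneg _ _ (by norm_num) (by norm_num)]
    norm_num
  have e2 : ∀ x, (ρ x ^ (1 / 2 : ℝ)) ^ (2 : ℝ) = ρ x := fun x => by
    rw [← ENNReal.rpow_mul]; norm_num
  simp only [Pi.mul_apply, e1, e2, h1, ENNReal.mul_rpow_of_nonneg _ _ (zero_le_two (α := ℝ)),
    ENNReal.one_rpow, one_mul] at key
  calc (∫⁻ x, ρ x * h x ∂μ) ^ 2
      ≤ ((∫⁻ x, ρ x * h x ^ (2 : ℝ) ∂μ) ^ (1 / 2 : ℝ)) ^ 2 := by gcongr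
    _ = ∫⁻ x, ρ x * h x ^ 2 ∂μ := by
      rw [← ENNReal.rpow_natCast, ← ENNReal.rpow_mul]; norm_num

end LIntegral

section Mollify

variable {F : Type*} [NormedAddCommGroup F] [NormedSpace ℝ F]

/-- Weighted Cauchy–Schwarz in `t`, then Tonelli. The general kernel `k` serves both `u (x - t)` and
`u x - u (x - t)`. -/
lemma lintegral_enorm_sq_integral_smul_le {ρ : R3 → ℝ} (hρ : Measurable ρ)
    (h1 : ∫⁻ t, ‖ρ t‖ₑ = 1) {k : R3 → R3 → F} (hk : StronglyMeasurable (Function.uncurry k)) :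
    ∫⁻ x, ‖∫ t, ρ t • k x t‖ₑ ^ 2 ≤ ∫⁻ t, ‖ρ t‖ₑ * ∫⁻ x, ‖k x t‖ₑ ^ 2 := by
  calc ∫⁻ x, ‖∫ t, ρ t • k x t‖ₑ ^ 2 ≤ ∫⁻ x, ∫⁻ t, ‖ρ t‖ₑ * ‖k x t‖ₑ ^ 2 := by
        refine lintegral_mono fun x => ?_
        refine le_trans ?_ (sq_lintegral_mul_le hρ.enorm.aemeasurable
          (hk.of_uncurry_left.enorm).aemeasurable h1)
        gcongr
        refine (enorm_integral_le_lintegral_enorm _).trans_eq ?_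
        simp only [enorm_smul]
    _ = ∫⁻ t, ∫⁻ x, ‖ρ t‖ₑ * ‖k x t‖ₑ ^ 2 := by
        refine lintegral_lintegral_swap (Measurable.aemeasurable ?_)
        exact (hρ.comp measurable_snd).enorm.mul (hk.enorm.pow_const 2)
    _ = _ := by
        refine lintegral_congr fun t => lintegral_const_mul _ ?_
        exact (hk.of_uncurry_right.enorm).pow_const 2

/-- Mollification by a normed bump function. -/
def mollify (φ : ContDiffBump (0 : R3)) (u : R3 → F) : R3 → F :=
  convolution (φ.normed volume) u (ContinuousLinearMap.lsmul ℝ ℝ) volume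

lemma mollify_apply (φ : ContDiffBump (0 : R3)) (u : R3 → F) (x : R3) :
    mollify φ u x = ∫ t, φ.normed volume t • u (x - t) := rfl

lemma mollify_apply' (φ : ContDiffBump (0 : R3)) (u : R3 → F) (x : R3) :
    mollify φ u x = ∫ t, φ.normed volume (x - t) • u t := by
  rw [mollify, convolution_eq_swap]; rfl

lemma lintegral_enorm_normed (φ : ContDiffBump (0 : R3)) :
    ∫⁻ t, ‖φ.normed volume t‖ₑ = 1 := by
  rw [← ofReal_integral_norm_eq_lintegral_enorm φ.integrable_normed]
  simp only [Real.norm_of_nonneg (φ.nonneg_normed _), φ.integral_normed, ENNReal.ofReal_one]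

lemma measurable_normed (φ : ContDiffBump (0 : R3)) : Measurable (φ.normed (volume : Measure R3)) :=
  φ.continuous_normed.measurable

lemma eLpNorm_mollify_le (φ : ContDiffBump (0 : R3)) {u : R3 → F} (hu : StronglyMeasurable u) :
    eLpNorm (mollify φ u) 2 volume ≤ eLpNorm u 2 volume := by
  refine (ENNReal.pow_le_pow_left_iff two_ne_zero).1 ?_
  rw [eLpNorm_two_sq, eLpNorm_two_sq]
  refine (lintegral_enorm_sq_integral_smul_le (k := fun x t => u (x - t)) (measurable_normed φ)
    (lintegral_enorm_normed φ) (hu.comp_measurable (measurable_fst.sub measurable_snd))).trans_eq ?_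
  simp_rw [fun t => lintegral_sub_right_eq_self (μ := volume) (fun x => ‖u x‖ₑ ^ 2) t]
  rw [lintegral_mul_const _ (measurable_normed φ).enorm, lintegral_enorm_normed, one_mul]

/-- The derivative falls on the kernel, and the weak gradient identity tested with `t ↦ φ.normed
volume (x - t)` moves it to `G`. The minus signs of the identity and of the reflection cancel. -/
lemma hasFDerivAt_mollify (φ : ContDiffBump (0 : R3)) {u : R3 → ℝ} {G : R3 → R3}
    (hu : MemLp u 2 volume) (hG : MemLp G 2 volume) (h : IsWeakGradient u G) (x : R3) :
    HasFDerivAt (mollify φ u) (innerSL ℝ (mollify φ G x)) x := by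
  have hul : LocallyIntegrable u volume := hu.locallyIntegrable (by norm_num)
  have hGl : LocallyIntegrable G volume := hG.locallyIntegrable (by norm_num)
  have hc := φ.hasCompactSupport_normed (μ := (volume : Measure R3))
  have hs : ContDiff ℝ ∞ (φ.normed (volume : Measure R3)) := φ.contDiff_normed
  have h1 := hc.hasFDerivAt_convolution_left (ContinuousLinearMap.lsmul ℝ ℝ)
    (hs.of_le (by simp)) hul x
  refine h1.congr_fderiv (ContinuousLinearMap.ext fun v => Eq.symm ?_)
  have hex := (hc.fderiv (𝕜 := ℝ)).convolutionExists_left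
    ((ContinuousLinearMap.lsmul ℝ ℝ : ℝ →L[ℝ] ℝ →L[ℝ] ℝ).precompL R3)
    (hs.continuous_fderiv (by simp)) hul x
  rw [convolution_eq_swap, ContinuousLinearMap.integral_apply hex.integrable_swap]
  have hψ : ContDiff ℝ ∞ (fun t => φ.normed volume (x - t)) :=
    hs.comp (contDiff_const.sub contDiff_id)
  have hψc : HasCompactSupport (fun t => φ.normed volume (x - t)) :=
    hc.comp_homeomorph (Homeomorph.subLeft x)
  have h2 := h _ hψ hψc v
  have h3 : ∀ t, fderiv ℝ (fun t => φ.normed volume (x - t)) t v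
      = - fderiv ℝ (φ.normed volume) (x - t) v := by
    intro t
    have := ((hs.differentiable (by simp)) (x - t)).hasFDerivAt.comp t
      ((hasFDerivAt_const x t).sub (hasFDerivAt_id t))
    have e := this.fderiv
    simp only [Function.comp_def] at e
    change fderiv ℝ (fun t => φ.normed volume (x - t)) t = _ at e
    rw [e]; simp
  simp only [h3, mul_neg, integral_neg, neg_inj] at h2
  have hexG : Integrable (fun t => φ.normed volume (x - t) • G t) :=
    (hc.convolutionExists_left (ContinuousLinearMap.lsmul ℝ ℝ) hs.continuous hGl x).integrable_swap
  have h4 : inner ℝ (mollify φ G x) v = ∫ t, φ.normed volume (x - t) * inner ℝ (G t) v := by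
    rw [mollify_apply', real_inner_comm, ← integral_inner hexG]
    simp only [real_inner_smul_right, real_inner_comm]
  rw [innerSL_apply_apply, h4, ← h2]
  refine integral_congr_ae (Eventually.of_forall fun t => ?_)
  simp [ContinuousLinearMap.precompL_apply, mul_comm]

lemma contDiff_mollify (φ : ContDiffBump (0 : R3)) {u : R3 → ℝ} (hu : MemLp u 2 volume) :
    ContDiff ℝ 1 (mollify φ u) :=
  φ.hasCompactSupport_normed.contDiff_convolution_left _ (n := 1) φ.contDiff_normed
    (hu.locallyIntegrable (by norm_num))

/-- A sequence of bump functions at the origin shrinking to a point. -/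
def shrinkingBump (n : ℕ) : ContDiffBump (0 : R3) where
  rIn := 1 / (n + 1)
  rOut := 2 / (n + 1)
  rIn_pos := by positivity
  rIn_lt_rOut := by gcongr; norm_num

lemma tendsto_shrinkingBump_rOut : Tendsto (fun n => (shrinkingBump n).rOut) atTop (𝓝 0) := by
  have := tendsto_one_div_add_atTop_nhds_zero_nat (𝕜 := ℝ)
  have h2 := this.const_mul 2
  rw [mul_zero] at h2
  refine h2.congr fun n => ?_
  simp only [shrinkingBump]; ring

lemma ae_tendsto_mollify [CompleteSpace F] {u : R3 → F} (hu : MemLp u 2 volume) :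
    ∀ᵐ x, Tendsto (fun n => mollify (shrinkingBump n) u x) atTop (𝓝 (u x)) :=
  -- The ratio `rOut / rIn` stays equal to 2; Lebesgue differentiation needs it bounded.
  ContDiffBump.ae_convolution_tendsto_right_of_locallyIntegrable (K := 2)
    tendsto_shrinkingBump_rOut (Eventually.of_forall fun n => by simp only [shrinkingBump]; ring_nf; rfl)
    (hu.locallyIntegrable (by norm_num))

end Mollify

end

/-! ### Translation estimates and the Sobolev inequality. -/

section

/-- Fundamental theorem of calculus on the segment from `x - h` to `x`, Cauchy–Schwarz on `[0, 1]`,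
and translation invariance. -/
lemma lintegral_translate_sub_le_fderiv {w : R3 → ℝ} (hw : ContDiff ℝ 1 w) (h : R3) :
    ∫⁻ x, ‖w x - w (x - h)‖ₑ ^ 2 ≤ ‖h‖ₑ ^ 2 * ∫⁻ x, ‖fderiv ℝ w x‖ₑ ^ 2 := by
  let ν : Measure ℝ := volume.restrict (Set.Ioc 0 1)
  have hν : ∫⁻ _ : ℝ, 1 ∂ν = 1 := by simp [ν]
  have hcont : Continuous (fderiv ℝ w) := hw.continuous_fderiv one_ne_zero
  have hm : Measurable (fun z : R3 × ℝ => ‖fderiv ℝ w (z.1 - h + z.2 • h)‖ₑ) :=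
    (hcont.comp (by fun_prop)).enorm.measurable
  have hpt : ∀ x, ‖w x - w (x - h)‖ₑ
      ≤ ∫⁻ s, 1 * (‖h‖ₑ * ‖fderiv ℝ w (x - h + s • h)‖ₑ) ∂ν := by
    intro x
    have hd : ∀ s ∈ Set.uIcc (0 : ℝ) 1,
        HasDerivAt (fun s : ℝ => w (x - h + s • h)) (fderiv ℝ w (x - h + s • h) h) s := by
      intro s _
      have h1 : HasDerivAt (fun s : ℝ => x - h + s • h) h s := by
        simpa using ((hasDerivAt_id s).smul_const h).const_add (x - h)
      exact ((hw.differentiable one_ne_zero) _).hasFDerivAt.comp_hasDerivAt s h1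
    have hcd : Continuous (fun s : ℝ => fderiv ℝ w (x - h + s • h) h) :=
      (hcont.comp (by fun_prop)).clm_apply continuous_const
    have := intervalIntegral.integral_eq_sub_of_hasDerivAt hd (hcd.intervalIntegrable 0 1)
    simp only [one_smul, zero_smul, add_zero, sub_add_cancel] at this
    rw [← this, intervalIntegral.integral_of_le zero_le_one]
    refine (enorm_integral_le_lintegral_enorm _).trans (lintegral_mono fun s => ?_)
    rw [one_mul, mul_comm]
    exact ContinuousLinearMap.le_opENorm _ _
  calc ∫⁻ x, ‖w x - w (x - h)‖ₑ ^ 2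
      ≤ ∫⁻ x, ∫⁻ s, ‖h‖ₑ ^ 2 * ‖fderiv ℝ w (x - h + s • h)‖ₑ ^ 2 ∂ν := by
        refine lintegral_mono fun x => ?_
        refine (pow_le_pow_left' (hpt x) 2).trans ?_
        refine (sq_lintegral_mul_le aemeasurable_const ?_ hν).trans_eq ?_
        · exact ((hm.comp (measurable_const.prodMk measurable_id)).const_mul _).aemeasurable
        · simp only [one_mul, mul_pow]
    _ = ∫⁻ s, ∫⁻ x, ‖h‖ₑ ^ 2 * ‖fderiv ℝ w (x - h + s • h)‖ₑ ^ 2 ∂volume ∂ν :=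
        lintegral_lintegral_swap (((hm.pow_const 2).const_mul _).aemeasurable)
    _ = ∫⁻ s, ‖h‖ₑ ^ 2 * ∫⁻ x, ‖fderiv ℝ w x‖ₑ ^ 2 ∂volume ∂ν := by
        refine lintegral_congr fun s => ?_
        have e : ∀ x : R3, x - h + s • h = x + (s • h - h) := fun x => by abel
        simp_rw [e]
        rw [lintegral_add_right_eq_self (μ := volume)
          (fun x => ‖h‖ₑ ^ 2 * ‖fderiv ℝ w x‖ₑ ^ 2) (s • h - h),
          lintegral_const_mul _ (hcont.enorm.measurable.pow_const 2)]
    _ = _ := by simp [ν]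

variable {u : R3 → ℝ} {G : R3 → R3}

lemma fderiv_mollify (φ : ContDiffBump (0 : R3))
    (hu : MemLp u 2 volume) (hG : MemLp G 2 volume) (h : IsWeakGradient u G) (x : R3) :
    fderiv ℝ (mollify φ u) x = innerSL ℝ (mollify φ G x) :=
  (hasFDerivAt_mollify φ hu hG h x).fderiv

lemma enorm_fderiv_mollify (φ : ContDiffBump (0 : R3))
    (hu : MemLp u 2 volume) (hG : MemLp G 2 volume) (h : IsWeakGradient u G) (x : R3) :
    ‖fderiv ℝ (mollify φ u) x‖ₑ = ‖mollify φ G x‖ₑ := by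
  rw [fderiv_mollify φ hu hG h, ← ofReal_norm, ← ofReal_norm, innerSL_apply_norm]

/-- The smooth estimate passes to the limit along mollifications: Fatou on the left, the `L²`
contraction `eLpNorm_mollify_le` on the right. -/
lemma lintegral_translate_sub_le (hu : MemLp u 2 volume) (hGm : StronglyMeasurable G)
    (hG : MemLp G 2 volume) (h : IsWeakGradient u G) (y : R3) :
    ∫⁻ x, ‖u x - u (x - y)‖ₑ ^ 2 ≤ ‖y‖ₑ ^ 2 * ∫⁻ x, ‖G x‖ₑ ^ 2 := by
  have hmeas : ∀ n, AEStronglyMeasurable (fun x =>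
      mollify (shrinkingBump n) u x - mollify (shrinkingBump n) u (x - y)) volume := fun n =>
    Continuous.aestronglyMeasurable <| (contDiff_mollify _ hu).continuous.sub
      ((contDiff_mollify _ hu).continuous.comp (continuous_id.sub continuous_const))
  have hae : ∀ᵐ x, Tendsto (fun n =>
      mollify (shrinkingBump n) u x - mollify (shrinkingBump n) u (x - y)) atTop
      (𝓝 (u x - u (x - y))) := by
    filter_upwards [ae_tendsto_mollify hu,
      (measurePreserving_sub_right volume y).quasiMeasurePreserving.ae (ae_tendsto_mollify hu)] with x h1 h2
    exact h1.sub h2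
  rw [← eLpNorm_two_sq, ← eLpNorm_two_sq, ← mul_pow]
  gcongr
  refine (Lp.eLpNorm_lim_le_liminf_eLpNorm hmeas _ hae).trans
    ((liminf_le_liminf (Eventually.of_forall fun n => ?_)).trans_eq
      (liminf_const (‖y‖ₑ * eLpNorm G 2 volume)))
  refine (ENNReal.pow_le_pow_left_iff two_ne_zero).1 ?_
  rw [eLpNorm_two_sq, mul_pow]
  refine (lintegral_translate_sub_le_fderiv (contDiff_mollify _ hu) y).trans ?_
  gcongr
  simp_rw [enorm_fderiv_mollify _ hu hG h]
  rw [← eLpNorm_two_sq]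
  exact pow_le_pow_left' (eLpNorm_mollify_le _ hGm) 2

/-- The error is an average of the differences `u x - u (x - t)` over `‖t‖ < φ.rOut`. The bound is
uniform on sets of bounded gradients, which is what Rellich's theorem requires. -/
lemma eLpNorm_sub_mollify_le (hum : StronglyMeasurable u) (hu : MemLp u 2 volume)
    (hGm : StronglyMeasurable G) (hG : MemLp G 2 volume) (h : IsWeakGradient u G)
    (φ : ContDiffBump (0 : R3)) :
    eLpNorm (fun x => u x - mollify φ u x) 2 volume
      ≤ ENNReal.ofReal φ.rOut * eLpNorm G 2 volume := by
  refine (ENNReal.pow_le_pow_left_iff two_ne_zero).1 ?_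
  rw [eLpNorm_two_sq, mul_pow, eLpNorm_two_sq]
  have hint : ∀ x, Integrable (fun t => φ.normed volume t • u (x - t)) := fun x =>
    φ.hasCompactSupport_normed.convolutionExists_left (ContinuousLinearMap.lsmul ℝ ℝ)
      φ.continuous_normed (hu.locallyIntegrable (by norm_num)) x
  have e : ∀ x, u x - mollify φ u x = ∫ t, φ.normed volume t • (u x - u (x - t)) := by
    intro x
    simp only [smul_sub]
    rw [integral_sub (φ.integrable_normed.smul_const _) (hint x), integral_smul_const,
      φ.integral_normed, one_smul, mollify_apply]
  simp_rw [e]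
  refine (lintegral_enorm_sq_integral_smul_le (k := fun x t => u x - u (x - t))
    (measurable_normed φ) (lintegral_enorm_normed φ)
    ((hum.comp_measurable measurable_fst).sub
      (hum.comp_measurable (measurable_fst.sub measurable_snd)))).trans ?_
  calc ∫⁻ t, ‖φ.normed volume t‖ₑ * ∫⁻ x, ‖u x - u (x - t)‖ₑ ^ 2
      ≤ ∫⁻ t, ‖φ.normed volume t‖ₑ * (ENNReal.ofReal φ.rOut ^ 2 * ∫⁻ x, ‖G x‖ₑ ^ 2) := by
        refine lintegral_mono fun t => ?_
        by_cases ht : t ∈ Function.support (φ.normed (volume : Measure R3))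
        · rw [φ.support_normed_eq, mem_ball_zero_iff] at ht
          refine mul_le_mul_right ((lintegral_translate_sub_le hu hGm hG h t).trans ?_) _
          gcongr
          rw [← ofReal_norm]
          exact ENNReal.ofReal_le_ofReal ht.le
        · simp [Function.notMem_support.1 ht]
    _ = _ := by
        rw [lintegral_mul_const _ (measurable_normed φ).enorm, lintegral_enorm_normed, one_mul]

/-- The cut-off function equal to `1` on the ball of radius `1`. -/
def cutoff : ContDiffBump (0 : R3) where
  rIn := 1
  rOut := 2
  rIn_pos := one_pos
  rIn_lt_rOut := one_lt_two

/-- The Gagliardo–Nirenberg–Sobolev inequality for compactly supported `C¹` functions is applied to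
cut-off mollifications of `u`, and Fatou gives the limit. The cut-off has derivative of size `K * c
n`, so its contribution disappears because `u ∈ L²`. -/
lemma exists_sobolev_const : ∃ C : NNReal, ∀ (u : R3 → ℝ) (G : R3 → R3),
    StronglyMeasurable u → MemLp u 2 volume → StronglyMeasurable G → MemLp G 2 volume →
    IsWeakGradient u G → eLpNorm u 6 volume ≤ C * eLpNorm G 2 volume := by
  obtain ⟨K, hK⟩ : ∃ K, ∀ x, ‖fderiv ℝ cutoff x‖ ≤ K :=
    ((cutoff.contDiff (n := 1)).continuous_fderiv one_ne_zero).bounded_above_of_compact_support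
      (cutoff.hasCompactSupport.fderiv (𝕜 := ℝ))
  have hK0 : 0 ≤ K := (norm_nonneg _).trans (hK 0)
  refine ⟨SNormLESNormFDerivOfEqConst ℝ (volume : Measure R3) (2 : NNReal), fun u G hum hu hGm hG h => ?_⟩
  set C := SNormLESNormFDerivOfEqConst ℝ (volume : Measure R3) (2 : NNReal)
  let c : ℕ → ℝ := fun n => 1 / ((n : ℝ) + 1)
  have hc0 : ∀ n, 0 < c n := fun n => by positivity
  let χ : ℕ → R3 → ℝ := fun n x => cutoff (c n • x)
  let m : ℕ → R3 → ℝ := fun n => mollify (shrinkingBump n) u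
  let w : ℕ → R3 → ℝ := fun n x => χ n x * m n x
  have hχ : ∀ n, ContDiff ℝ 1 (χ n) := fun n => cutoff.contDiff.comp (contDiff_const_smul _)
  have hχc : ∀ n, HasCompactSupport (χ n) := fun n =>
    cutoff.hasCompactSupport.comp_homeomorph (Homeomorph.smulOfNeZero (c n) (hc0 n).ne')
  have hm : ∀ n, ContDiff ℝ 1 (m n) := fun n => contDiff_mollify _ hu
  have hw : ∀ n, ContDiff ℝ 1 (w n) := fun n => (hχ n).mul (hm n)
  have hχd : ∀ n x, ‖fderiv ℝ (χ n) x‖ ≤ K * c n := by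
    intro n x
    have h1 : HasFDerivAt (χ n) ((fderiv ℝ cutoff (c n • x)).comp
        (c n • ContinuousLinearMap.id ℝ R3)) x :=
      (((cutoff.contDiff (n := 1)).differentiable one_ne_zero) _).hasFDerivAt.comp x
        ((hasFDerivAt_id x).const_smul (c n))
    rw [h1.fderiv, ContinuousLinearMap.comp_smul, ContinuousLinearMap.comp_id, norm_smul,
      Real.norm_of_nonneg (hc0 n).le, mul_comm]
    exact mul_le_mul_of_nonneg_right (hK _) (hc0 n).le
  have hwd : ∀ n x, ‖fderiv ℝ (w n) x‖ ≤ ‖‖mollify (shrinkingBump n) G x‖ + K * c n * ‖m n x‖‖ := by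
    intro n x
    have h1 := ((hχ n).differentiable one_ne_zero x).hasFDerivAt.mul
      ((hm n).differentiable one_ne_zero x).hasFDerivAt
    rw [show fderiv ℝ (w n) x = _ from h1.fderiv, fderiv_mollify _ hu hG h,
      Real.norm_of_nonneg (by have := hc0 n; positivity)]
    refine (norm_add_le _ _).trans (add_le_add ?_ ?_)
    · rw [norm_smul, innerSL_apply_norm]
      refine mul_le_of_le_one_left (norm_nonneg _) ?_
      rw [Real.norm_of_nonneg cutoff.nonneg]
      exact cutoff.le_one
    · rw [norm_smul, mul_comm]
      exact mul_le_mul_of_nonneg_right (hχd n x) (norm_nonneg _)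
  have hGc : ∀ n, Continuous (mollify (shrinkingBump n) G) := fun n =>
    ((shrinkingBump n).hasCompactSupport_normed.contDiff_convolution_left _ (n := 0)
      (shrinkingBump n).contDiff_normed (hG.locallyIntegrable (by norm_num))).continuous
  have hbound : ∀ n, eLpNorm (w n) 6 volume
      ≤ C * (eLpNorm G 2 volume + ENNReal.ofReal (K * c n) * eLpNorm u 2 volume) := by
    intro n
    -- The exponents satisfy `1/6 = 1/2 - 1/3` in dimension three.
    have h1 := eLpNorm_le_eLpNorm_fderiv_of_eq (F := ℝ) (volume : Measure R3) (hw n)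
      ((hχc n).mul_right) (p := 2) (p' := 6) (by norm_num) (by simp)
      (by simp; norm_num)
    refine (h1.trans ?_)
    gcongr
    refine (eLpNorm_mono (hwd n)).trans ?_
    refine (eLpNorm_add_le (hGc n).norm.aestronglyMeasurable
      ((hm n).continuous.norm.const_smul (K * c n)).aestronglyMeasurable (by norm_num)).trans ?_
    gcongr
    · rw [eLpNorm_norm]
      exact eLpNorm_mollify_le _ hGm
    · refine (eLpNorm_const_smul_le (c := K * c n) (f := fun x => ‖m n x‖)).trans ?_
      rw [eLpNorm_norm, ← ofReal_norm, Real.norm_of_nonneg (by have := hc0 n; positivity)]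
      gcongr
      exact eLpNorm_mollify_le _ hum
  have hct : Tendsto c atTop (𝓝 0) := tendsto_one_div_add_atTop_nhds_zero_nat
  have hae : ∀ᵐ x, Tendsto (fun n => w n x) atTop (𝓝 (u x)) := by
    filter_upwards [ae_tendsto_mollify hu] with x hx
    have h1 : Tendsto (fun n => χ n x) atTop (𝓝 1) := by
      have h2 : Tendsto (fun n => c n • x) atTop (𝓝 0) := by
        simpa using hct.smul_const x
      have h3 := (cutoff.continuous.tendsto 0).comp h2
      rwa [cutoff.one_of_mem_closedBall (by simp [cutoff])] at h3
    simpa using h1.mul hx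
  have hlim : Tendsto (fun n => C * (eLpNorm G 2 volume + ENNReal.ofReal (K * c n) *
      eLpNorm u 2 volume)) atTop (𝓝 (C * (eLpNorm G 2 volume + ENNReal.ofReal (K * 0) *
      eLpNorm u 2 volume))) := by
    refine ENNReal.Tendsto.const_mul (Tendsto.const_add _ (ENNReal.Tendsto.mul_const
      (ENNReal.tendsto_ofReal (hct.const_mul K)) (Or.inr hu.2.ne))) (Or.inr ENNReal.coe_ne_top)
  refine (Lp.eLpNorm_lim_le_liminf_eLpNorm (fun n => (hw n).continuous.aestronglyMeasurable) _
    hae).trans ((liminf_le_liminf (Eventually.of_forall hbound)).trans_eq ?_)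
  rw [hlim.liminf_eq]
  simp

end

/-! ### Weak compactness and Rellich's theorem. -/

section

/-- Sequential Banach–Alaoglu in the dual of a separable space, transported to `H` by the Riesz
isomorphism. -/
lemma exists_subseq_weakly_tendsto {H : Type*} [NormedAddCommGroup H] [InnerProductSpace ℝ H]
    [CompleteSpace H] [TopologicalSpace.SeparableSpace H] {x : ℕ → H} {C : ℝ}
    (hx : ∀ n, ‖x n‖ ≤ C) : ∃ (y : H) (k : ℕ → ℕ), StrictMono k ∧
      ∀ z, Tendsto (fun n => inner ℝ (x (k n)) z) atTop (𝓝 (inner ℝ y z)) := by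
  let ξ : ℕ → WeakDual ℝ H := fun n => WeakDual.toStrongDual.symm (InnerProductSpace.toDual ℝ H (x n))
  obtain ⟨η, -, k, hk, hη⟩ := WeakDual.isSeqCompact_closedBall ℝ H 0 C (x := ξ) (fun n => by
    simpa [ξ] using hx n)
  refine ⟨(InnerProductSpace.toDual ℝ H).symm (WeakDual.toStrongDual η), k, hk, fun z => ?_⟩
  have h1 := ((WeakDual.eval_continuous z).tendsto η).comp hη
  have h2 : inner ℝ ((InnerProductSpace.toDual ℝ H).symm (WeakDual.toStrongDual η)) z = η z := by
    rw [InnerProductSpace.toDual_symm_apply]; rfl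
  rw [h2]
  exact h1

/-- Makes the separability of `L²` available for extracting weakly convergent subsequences. -/
instance : Fact ((2 : ℝ≥0∞) ≠ ⊤) := ⟨by simp⟩

lemma inner_toLp {F : Type*} [NormedAddCommGroup F] [InnerProductSpace ℝ F] {g : R3 → F}
    (w : Lp F 2 (volume : Measure R3)) (hg : MemLp g 2 volume) :
    inner ℝ w (hg.toLp g) = ∫ x, inner ℝ (w x) (g x) := by
  rw [L2.inner_def]
  refine integral_congr_ae ?_
  filter_upwards [hg.coeFn_toLp] with x hx
  rw [hx]

/-- Both sides of the weak gradient identity are pairings with fixed `L²` functions, hence weakly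
continuous. -/
lemma isWeakGradient_of_weakly_tendsto {u : ℕ → Lp ℝ 2 (volume : Measure R3)}
    {G : ℕ → Lp R3 2 (volume : Measure R3)} {v : Lp ℝ 2 (volume : Measure R3)}
    {K : Lp R3 2 (volume : Measure R3)} (h : ∀ n, IsWeakGradient (u n) (G n))
    (hu : ∀ z, Tendsto (fun n => inner ℝ (u n) z) atTop (𝓝 (inner ℝ v z)))
    (hG : ∀ z, Tendsto (fun n => inner ℝ (G n) z) atTop (𝓝 (inner ℝ K z))) :
    IsWeakGradient v K := by
  intro φ hφ hc e
  have m1 := memLp_test_fderiv hφ hc e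
  have m2 : MemLp (fun x => φ x • e) 2 volume :=
    (hφ.continuous.smul continuous_const).memLp_of_hasCompactSupport hc.smul_right
  have h1 := hu (m1.toLp _)
  have h2 := (hG (m2.toLp _)).neg
  simp only [inner_toLp, RCLike.inner_apply, conj_trivial, real_inner_smul_right] at h1 h2
  simp only [mul_comm (fderiv ℝ φ _ e)] at h1
  refine tendsto_nhds_unique h1 (h2.congr fun n => ?_)
  rw [h n φ hφ hc e]

/-- Cauchy–Schwarz; reflecting and translating the kernel preserves its `L²` norm, so the bound is
uniform in `x`. -/
lemma enorm_mollify_le (φ : ContDiffBump (0 : R3)) (d : Lp ℝ 2 (volume : Measure R3)) (x : R3) :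
    ‖mollify φ d x‖ₑ ≤ eLpNorm (φ.normed (volume : Measure R3)) 2 volume * ‖d‖ₑ := by
  have hm : MemLp (fun t => φ.normed volume (x - t)) 2 volume :=
    memLp_test (φ.continuous_normed.comp (by fun_prop))
      (φ.hasCompactSupport_normed.comp_homeomorph (Homeomorph.subLeft x))
  have e1 : mollify φ d x = inner ℝ d (hm.toLp _) := by
    rw [inner_toLp, mollify_apply']; simp
  have e2 : ‖hm.toLp _‖ₑ = eLpNorm (φ.normed (volume : Measure R3)) 2 volume := by
    rw [Lp.enorm_toLp]
    exact eLpNorm_comp_measurePreserving (f := fun t => x - t) (g := φ.normed volume)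
      φ.continuous_normed.aestronglyMeasurable (Measure.measurePreserving_sub_left volume x)
  rw [e1, ← e2, mul_comm]
  simp only [← ofReal_norm]
  rw [← ENNReal.ofReal_mul (norm_nonneg _)]
  exact ENNReal.ofReal_le_ofReal (norm_inner_le_norm _ _)

lemma tendsto_mollify_of_weakly_tendsto (φ : ContDiffBump (0 : R3))
    {d : ℕ → Lp ℝ 2 (volume : Measure R3)}
    (hd : ∀ z, Tendsto (fun n => inner ℝ (d n) z) atTop (𝓝 0)) (x : R3) :
    Tendsto (fun n => mollify φ (d n) x) atTop (𝓝 0) := by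
  have hm : MemLp (fun t => φ.normed volume (x - t)) 2 volume :=
    memLp_test (φ.continuous_normed.comp (by fun_prop))
      (φ.hasCompactSupport_normed.comp_homeomorph (Homeomorph.subLeft x))
  refine (hd (hm.toLp _)).congr fun n => ?_
  rw [inner_toLp, mollify_apply']; simp

/-- Split `d n` into a mollification and an error. For a fixed kernel the mollifications tend to
zero pointwise and are uniformly bounded, so dominated convergence applies on the ball; the error is
at most `rOut * C` for all `n` at once. -/
lemma tendsto_eLpNorm_closedBall_of_weakly_tendsto {d : ℕ → Lp ℝ 2 (volume : Measure R3)}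
    {g : ℕ → Lp R3 2 (volume : Measure R3)} {C : ℝ} (hw : ∀ n, IsWeakGradient (d n) (g n))
    (hdC : ∀ n, ‖d n‖ ≤ C) (hgC : ∀ n, ‖g n‖ ≤ C)
    (hd : ∀ z, Tendsto (fun n => inner ℝ (d n) z) atTop (𝓝 0)) (R : ℝ) :
    Tendsto (fun n => eLpNorm (d n) 2 (volume.restrict (Metric.closedBall 0 R))) atTop (𝓝 0) := by
  have hC : 0 ≤ C := (norm_nonneg _).trans (hdC 0)
  set μ : Measure R3 := volume.restrict (Metric.closedBall 0 R)
  have hμ : μ Set.univ ≠ ⊤ := by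
    rw [Measure.restrict_apply_univ]
    exact measure_closedBall_lt_top.ne
  have hcont : ∀ φ n, Continuous (mollify φ (d n)) := fun φ n =>
    (contDiff_mollify φ (Lp.memLp (d n))).continuous
  have hen : ∀ {F : Type} [NormedAddCommGroup F] (w : Lp F 2 (volume : Measure R3)), ‖w‖ ≤ C →
      ‖w‖ₑ ≤ ENNReal.ofReal C := fun w hw' => by
    rw [← ofReal_norm]; exact ENNReal.ofReal_le_ofReal hw'
  have h1 : ∀ φ : ContDiffBump (0 : R3),
      Tendsto (fun n => eLpNorm (mollify φ (d n)) 2 μ) atTop (𝓝 0) := by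
    intro φ
    set B := eLpNorm (φ.normed (volume : Measure R3)) 2 volume * ENNReal.ofReal C
    have hB : B ≠ ⊤ := ENNReal.mul_ne_top
      (memLp_test φ.continuous_normed φ.hasCompactSupport_normed).2.ne ENNReal.ofReal_ne_top
    have h2 := tendsto_lintegral_of_dominated_convergence (μ := μ)
      (F := fun n x => ‖mollify φ (d n) x‖ₑ ^ 2) (f := fun _ => 0) (fun _ => B ^ 2)
      (fun n => (hcont φ n).enorm.measurable.pow_const 2)
      (fun n => Eventually.of_forall fun x => by
        refine pow_le_pow_left' ((enorm_mollify_le φ _ x).trans ?_) 2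
        exact mul_le_mul_right (hen _ (hdC n)) _)
      (by rw [lintegral_const]; exact ENNReal.mul_ne_top (ENNReal.pow_ne_top hB) hμ)
      (Eventually.of_forall fun x => by
        have h3 := ENNReal.Tendsto.pow (n := 2) ((continuous_enorm.tendsto (0 : ℝ)).comp
          (tendsto_mollify_of_weakly_tendsto φ hd x))
        simpa using h3)
    simp only [← eLpNorm_two_sq, lintegral_zero] at h2
    have h4 := ((ENNReal.continuous_rpow_const (y := 1 / 2)).tendsto _).comp h2
    have h5 : ∀ x : ℝ≥0∞, (x ^ 2) ^ (1 / 2 : ℝ) = x := fun x => by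
      rw [← ENNReal.rpow_natCast, ← ENNReal.rpow_mul]; norm_num
    simpa only [Function.comp_def, h5,
      ENNReal.zero_rpow_of_pos (show (0 : ℝ) < 1 / 2 by norm_num)] using h4
  refine ENNReal.tendsto_nhds_zero.2 fun ε hε => ?_
  obtain ⟨N, hN⟩ : ∃ N, ENNReal.ofReal (shrinkingBump N).rOut * ENNReal.ofReal C ≤ ε / 2 := by
    have h6 : Tendsto (fun N => ENNReal.ofReal (shrinkingBump N).rOut * ENNReal.ofReal C) atTop
        (𝓝 (ENNReal.ofReal 0 * ENNReal.ofReal C)) :=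
      ENNReal.Tendsto.mul_const (ENNReal.tendsto_ofReal tendsto_shrinkingBump_rOut)
        (Or.inr ENNReal.ofReal_ne_top)
    rw [ENNReal.ofReal_zero, zero_mul] at h6
    exact (ENNReal.tendsto_nhds_zero.1 h6 _ (ENNReal.half_pos hε.ne')).exists
  filter_upwards [ENNReal.tendsto_nhds_zero.1 (h1 (shrinkingBump N)) _ (ENNReal.half_pos hε.ne')]
    with n hn
  set m := mollify (shrinkingBump N) (d n)
  have hsm : AEStronglyMeasurable (fun x => d n x - m x) volume :=
    (Lp.aestronglyMeasurable _).sub (hcont _ n).aestronglyMeasurable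
  calc eLpNorm (d n) 2 μ = eLpNorm ((fun x => d n x - m x) + m) 2 μ := by
        congr 1; ext x; simp
    _ ≤ eLpNorm (fun x => d n x - m x) 2 μ + eLpNorm m 2 μ :=
        eLpNorm_add_le (hsm.mono_measure Measure.restrict_le_self)
          (hcont _ n).aestronglyMeasurable (by norm_num)
    _ ≤ ε / 2 + ε / 2 := by
        refine add_le_add (le_trans ?_ hN) hn
        refine (eLpNorm_mono_measure _ Measure.restrict_le_self).trans ?_
        refine (eLpNorm_sub_mollify_le (Lp.stronglyMeasurable _) (Lp.memLp _)
          (Lp.stronglyMeasurable _) (Lp.memLp _) (hw n) _).trans ?_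
        gcongr
        rw [← Lp.enorm_def]
        exact hen _ (hgC n)
    _ = ε := ENNReal.add_halves ε

lemma setIntegral_sq_eq_toReal_eLpNorm {d : R3 → ℝ} {s : Set R3}
    (hd : AEStronglyMeasurable d volume) :
    ∫ x in s, d x ^ 2 = (eLpNorm d 2 (volume.restrict s) ^ 2).toReal := by
  rw [eLpNorm_two_sq, integral_eq_lintegral_of_nonneg_ae (Eventually.of_forall fun x => sq_nonneg _)
    ((hd.mono_measure Measure.restrict_le_self).pow 2)]
  congr 1
  refine lintegral_congr fun x => ?_
  rw [← ofReal_norm, ← ENNReal.ofReal_pow (norm_nonneg _), Real.norm_eq_abs, sq_abs]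

/-- Rellich's theorem: bounded sequences in `H¹(ℝ³)` have subsequences converging in `L²_loc`. -/
theorem exists_subseq_tendsto_L2_loc {u : ℕ → Lp ℝ 2 (volume : Measure R3)}
    {G : ℕ → Lp R3 2 (volume : Measure R3)} {C : ℝ} (hw : ∀ n, IsWeakGradient (u n) (G n))
    (hu : ∀ n, ‖u n‖ ≤ C) (hG : ∀ n, ‖G n‖ ≤ C) :
    ∃ (v : Lp ℝ 2 (volume : Measure R3)) (k : ℕ → ℕ), StrictMono k ∧
      ∀ R, Tendsto (fun n => ∫ x in Metric.closedBall 0 R, (u (k n) x - v x) ^ 2) atTop (𝓝 0) := by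
  obtain ⟨v, k, hk, hv⟩ := exists_subseq_weakly_tendsto hu
  obtain ⟨K, l, hl, hK⟩ := exists_subseq_weakly_tendsto (fun n => hG (k n))
  have hv' : ∀ z, Tendsto (fun n => inner ℝ (u (k (l n))) z) atTop (𝓝 (inner ℝ v z)) :=
    fun z => (hv z).comp hl.tendsto_atTop
  have hvK : IsWeakGradient v K := isWeakGradient_of_weakly_tendsto (fun n => hw (k (l n))) hv' hK
  refine ⟨v, k ∘ l, hk.comp hl, fun R => ?_⟩
  have hd : ∀ n, IsWeakGradient (u (k (l n)) - v : Lp ℝ 2 (volume : Measure R3))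
      (G (k (l n)) - K : Lp R3 2 (volume : Measure R3)) := fun n =>
    (sobolevH1.sub_mem (x := (u (k (l n)), G (k (l n)))) (y := (v, K)) (hw _) hvK)
  have h1 := tendsto_eLpNorm_closedBall_of_weakly_tendsto (C := C + ‖v‖ + ‖K‖) hd
    (fun n => (norm_sub_le _ _).trans (by linarith [hu (k (l n)), norm_nonneg K]))
    (fun n => (norm_sub_le _ _).trans (by linarith [hG (k (l n)), norm_nonneg v]))
    (fun z => by
      have := (hv' z).sub_const (inner ℝ v z)
      simpa only [← inner_sub_left, sub_self] using this) R
  have h2 := ((ENNReal.tendsto_toReal (by simp)).comp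
    (ENNReal.Tendsto.pow (n := 2) h1)).congr fun n => (setIntegral_sq_eq_toReal_eLpNorm (Lp.aestronglyMeasurable _)).symm
  simp only [ne_eq, OfNat.ofNat_ne_zero, not_false_eq_true, zero_pow, ENNReal.toReal_zero] at h2
  refine h2.congr fun n => integral_congr_ae ?_
  filter_upwards [ae_restrict_of_ae (Lp.coeFn_sub (u (k (l n))) v)] with x hx
  rw [hx]; rfl

end

/-! ### The space `E`: embeddings, completeness, negative part of the potential. -/

section

lemma L2_norm_sq_eq_integral {F : Type*} [NormedAddCommGroup F] [InnerProductSpace ℝ F]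
    (w : Lp F 2 (volume : Measure R3)) : ‖w‖ ^ 2 = ∫ x, ‖w x‖ ^ 2 := by
  rw [← real_inner_self_eq_norm_sq, L2.inner_def]
  simp only [real_inner_self_eq_norm_sq]

namespace EnergySpace

variable {a : ℝ} {ha : 0 < a} {V : C(R3, ℝ)}

lemma fn_sub (u v : EnergySpace a ha V) : (u - v).fn = u.fn - v.fn := rfl
lemma grad_add (u v : EnergySpace a ha V) : (u + v).grad = u.grad + v.grad := rfl
lemma grad_sub (u v : EnergySpace a ha V) : (u - v).grad = u.grad - v.grad := rfl
lemma grad_smul (c : ℝ) (u : EnergySpace a ha V) : (c • u).grad = c • u.grad := rfl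

lemma fn_sub_ae (u v : EnergySpace a ha V) :
    ((u - v).fn : R3 → ℝ) =ᵐ[volume] fun x => u.fn x - v.fn x := Lp.coeFn_sub _ _

lemma fn_add_ae (u v : EnergySpace a ha V) :
    ((u + v).fn : R3 → ℝ) =ᵐ[volume] fun x => u.fn x + v.fn x := Lp.coeFn_add _ _

lemma fn_smul_ae (c : ℝ) (u : EnergySpace a ha V) :
    ((c • u).fn : R3 → ℝ) =ᵐ[volume] fun x => c * u.fn x := Lp.coeFn_smul _ _

lemma isWeakGradient (u : EnergySpace a ha V) : IsWeakGradient u.fn u.grad := u.2.1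

lemma norm_sq_eq (u : EnergySpace a ha V) :
    ‖u‖ ^ 2 = a * ‖u.grad‖ ^ 2 + ∫ x, posPart V x * u.fn x ^ 2 := by
  rw [norm_sq_def, integral_add ((integrable_grad_sq _).const_mul a) u.integrable_pot,
    integral_const_mul, L2_norm_sq_eq_integral]

lemma integral_pot_nonneg (u : EnergySpace a ha V) : 0 ≤ ∫ x, posPart V x * u.fn x ^ 2 :=
  integral_nonneg fun x => mul_nonneg (posPart_nonneg V x) (sq_nonneg _)

lemma norm_grad_sq_le (u : EnergySpace a ha V) : a * ‖u.grad‖ ^ 2 ≤ ‖u‖ ^ 2 := by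
  rw [norm_sq_eq]; linarith [u.integral_pot_nonneg]

lemma integral_pot_le (u : EnergySpace a ha V) :
    ∫ x, posPart V x * u.fn x ^ 2 ≤ ‖u‖ ^ 2 := by
  rw [norm_sq_eq]
  have : 0 ≤ a * ‖u.grad‖ ^ 2 := by positivity
  linarith

lemma norm_grad_le (u : EnergySpace a ha V) : ‖u.grad‖ ≤ (Real.sqrt a)⁻¹ * ‖u‖ := by
  have hs : 0 < Real.sqrt a := Real.sqrt_pos.2 ha
  rw [inv_mul_eq_div, le_div_iff₀ hs]
  refine abs_le_of_sq_le_sq' ?_ (norm_nonneg _) |>.2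
  rw [mul_pow, Real.sq_sqrt ha.le, mul_comm]
  exact u.norm_grad_sq_le

lemma integrable_fn_sq (u : EnergySpace a ha V) : Integrable (fun x => u.fn x ^ 2) :=
  (Lp.memLp u.fn).integrable_sq

variable (a ha V) in
lemma exists_eLpNorm_six_le : ∃ S : ℝ, 0 < S ∧ ∀ u : EnergySpace a ha V,
    eLpNorm u.fn 6 volume ≤ ENNReal.ofReal (S * ‖u‖) := by
  obtain ⟨C, hC⟩ := exists_sobolev_const
  refine ⟨(C + 1) * (Real.sqrt a)⁻¹, by have := Real.sqrt_pos.2 ha; positivity, fun u => ?_⟩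
  refine (hC _ _ (Lp.stronglyMeasurable _) (Lp.memLp _) (Lp.stronglyMeasurable _) (Lp.memLp _)
    u.isWeakGradient).trans ?_
  rw [← Lp.enorm_def, ← ofReal_norm, mul_assoc, ENNReal.ofReal_mul (by positivity)]
  refine mul_le_mul' ?_ (ENNReal.ofReal_le_ofReal u.norm_grad_le)
  rw [← ENNReal.ofReal_coe_nnreal]
  exact ENNReal.ofReal_le_ofReal (by linarith)

/-- Hölder with `1/2 = 1/6 + 1/3` on a set of finite measure. -/
lemma setIntegral_sq_le {S : ℝ} (hS : 0 < S) {u : EnergySpace a ha V}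
    (hu : eLpNorm u.fn 6 volume ≤ ENNReal.ofReal (S * ‖u‖)) {s : Set R3} (hs : volume s ≠ ⊤) :
    ∫ x in s, u.fn x ^ 2 ≤ (S * ‖u‖) ^ 2 * ((volume s).toReal ^ (1 / 3 : ℝ)) ^ 2 := by
  rw [setIntegral_sq_eq_toReal_eLpNorm (Lp.aestronglyMeasurable _), ← mul_pow, ENNReal.toReal_pow]
  gcongr
  have h1 := eLpNorm_le_eLpNorm_mul_rpow_measure_univ (μ := volume.restrict s) (f := u.fn)
    (p := 2) (q := 6) (by norm_num)
    ((Lp.aestronglyMeasurable _).mono_measure Measure.restrict_le_self)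
  rw [Measure.restrict_apply_univ] at h1
  have h2 : eLpNorm u.fn 2 (volume.restrict s)
      ≤ ENNReal.ofReal (S * ‖u‖) * volume s ^ (1 / 3 : ℝ) := by
    refine h1.trans (mul_le_mul' ((eLpNorm_mono_measure _ Measure.restrict_le_self).trans hu) ?_)
    norm_num
  have h3 := ENNReal.toReal_mono (ENNReal.mul_ne_top ENNReal.ofReal_ne_top
    (ENNReal.rpow_ne_top_of_nonneg (by norm_num) hs)) h2
  rwa [ENNReal.toReal_mul, ENNReal.toReal_ofReal (by positivity), ← ENNReal.toReal_rpow] at h3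

/-- Under `(V1)` the space `E` embeds into `L²` and into `L⁶`, and the gradient is bounded. -/
lemma exists_embedding_const (hV : CondV1 V) : ∃ S : ℝ, 0 < S ∧ ∀ u : EnergySpace a ha V,
    ‖u.fn‖ ≤ S * ‖u‖ ∧ eLpNorm u.fn 6 volume ≤ ENNReal.ofReal (S * ‖u‖) ∧
      ‖u.grad‖ ≤ S * ‖u‖ := by
  obtain ⟨-, M, hM, -, hfin⟩ := hV
  obtain ⟨S, hS, h6⟩ := exists_eLpNorm_six_le a ha V
  set A : Set R3 := {x | posPart V x < M} with hA
  have hAm : MeasurableSet A := (isOpen_lt (continuous_posPart V) continuous_const).measurableSet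
  -- The first summand comes from Hölder on `A`, the second from `1 ≤ M⁻¹ * posPart V x` off `A`.
  set D : ℝ := S ^ 2 * ((volume A).toReal ^ (1 / 3 : ℝ)) ^ 2 + M⁻¹ with hD
  have hD0 : 0 ≤ D := by positivity
  refine ⟨S + Real.sqrt D + (Real.sqrt a)⁻¹, by positivity, fun u => ⟨?_, ?_, ?_⟩⟩
  · have h1 : ‖u.fn‖ ^ 2 ≤ D * ‖u‖ ^ 2 := by
      rw [L2_norm_sq_eq_integral]
      simp only [Real.norm_eq_abs, sq_abs]
      rw [← integral_add_compl hAm u.integrable_fn_sq, hD, add_mul]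
      refine add_le_add ((setIntegral_sq_le hS (h6 u) hfin.ne).trans_eq (by ring)) ?_
      calc ∫ x in Aᶜ, u.fn x ^ 2 ≤ ∫ x in Aᶜ, M⁻¹ * (posPart V x * u.fn x ^ 2) := by
            refine setIntegral_mono_on u.integrable_fn_sq.integrableOn
              (u.integrable_pot.const_mul _).integrableOn hAm.compl fun x hx => ?_
            have hx' : M ≤ posPart V x := not_lt.1 hx
            rw [← mul_assoc]
            refine le_mul_of_one_le_left (sq_nonneg _) ?_
            rw [inv_mul_eq_div, one_le_div hM]
            exact hx'
        _ ≤ ∫ x, M⁻¹ * (posPart V x * u.fn x ^ 2) :=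
            setIntegral_le_integral (u.integrable_pot.const_mul _) (Eventually.of_forall fun x =>
              mul_nonneg (by positivity) (mul_nonneg (posPart_nonneg V x) (sq_nonneg _)))
        _ ≤ M⁻¹ * ‖u‖ ^ 2 := by
            rw [integral_const_mul]
            exact mul_le_mul_of_nonneg_left u.integral_pot_le (by positivity)
    have h2 : ‖u.fn‖ ≤ Real.sqrt D * ‖u‖ := by
      refine (abs_le_of_sq_le_sq' ?_ (by positivity)).2
      rwa [mul_pow, Real.sq_sqrt hD0]
    refine h2.trans (mul_le_mul_of_nonneg_right ?_ (norm_nonneg _))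
    have : 0 ≤ (Real.sqrt a)⁻¹ := by positivity
    linarith
  · refine (h6 u).trans (ENNReal.ofReal_le_ofReal (mul_le_mul_of_nonneg_right ?_ (norm_nonneg _)))
    have : 0 ≤ (Real.sqrt a)⁻¹ := by positivity
    linarith [Real.sqrt_nonneg D]
  · refine u.norm_grad_le.trans (mul_le_mul_of_nonneg_right ?_ (norm_nonneg _))
    linarith [Real.sqrt_nonneg D]

lemma lintegral_pot (u : EnergySpace a ha V) :
    ∫⁻ x, ENNReal.ofReal (posPart V x * u.fn x ^ 2) ≤ ENNReal.ofReal (‖u‖ ^ 2) := by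
  rw [← ofReal_integral_eq_lintegral_ofReal u.integrable_pot (Eventually.of_forall fun x =>
    mul_nonneg (posPart_nonneg V x) (sq_nonneg _))]
  exact ENNReal.ofReal_le_ofReal u.integral_pot_le

lemma tendsto_coeFn_ae_of_tendsto {u : ℕ → Lp ℝ 2 (volume : Measure R3)}
    {v : Lp ℝ 2 (volume : Measure R3)} (h : Tendsto u atTop (𝓝 v)) :
    ∃ k : ℕ → ℕ, StrictMono k ∧ ∀ᵐ x, Tendsto (fun n => u (k n) x) atTop (𝓝 (v x)) :=
  (tendstoInMeasure_of_tendsto_Lp h).exists_seq_tendsto_ae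

/-- Functions and gradients converge in `L²` by the embedding, and the weak gradient relation is
closed. The weight `V⁺` may be unbounded, so the potential term is handled by Fatou along an a.e.
convergent subsequence. -/
theorem completeSpace (hV : CondV1 V) : CompleteSpace (EnergySpace a ha V) := by
  obtain ⟨S, hS, hemb⟩ := exists_embedding_const (ha := ha) hV
  refine Metric.complete_of_cauchySeq_tendsto fun u hu => ?_
  have hcauchy : ∀ {F : Type} [NormedAddCommGroup F] (w : ℕ → Lp F 2 (volume : Measure R3)),
      (∀ n m, ‖w n - w m‖ ≤ S * ‖u n - u m‖) → CauchySeq w := by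
    intro F _ w hw
    rw [Metric.cauchySeq_iff] at hu ⊢
    intro ε hε
    obtain ⟨N, hN⟩ := hu (ε / S) (by positivity)
    refine ⟨N, fun m hm n hn => ?_⟩
    rw [dist_eq_norm]
    have := hN m hm n hn
    rw [dist_eq_norm, lt_div_iff₀ hS] at this
    linarith [hw m n]
  obtain ⟨v, hv⟩ := cauchySeq_tendsto_of_complete
    (hcauchy (fun n => (u n).fn) fun n m => (hemb (u n - u m)).1)
  obtain ⟨K, hK⟩ := cauchySeq_tendsto_of_complete
    (hcauchy (fun n => (u n).grad) fun n m => (hemb (u n - u m)).2.2)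
  have hvK : IsWeakGradient v K := isWeakGradient_of_weakly_tendsto (fun n => (u n).isWeakGradient)
    (fun z => hv.inner tendsto_const_nhds) (fun z => hK.inner tendsto_const_nhds)
  obtain ⟨k, hk, hae⟩ := tendsto_coeFn_ae_of_tendsto hv
  have hfatou : ∀ ε > 0, ∃ N, ∀ n ≥ N,
      ∫⁻ x, ENNReal.ofReal (posPart V x * ((u n).fn x - v x) ^ 2) ≤ ENNReal.ofReal (ε ^ 2) := by
    intro ε hε
    obtain ⟨N, hN⟩ := Metric.cauchySeq_iff.1 hu ε hε
    refine ⟨N, fun n hn => ?_⟩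
    calc ∫⁻ x, ENNReal.ofReal (posPart V x * ((u n).fn x - v x) ^ 2)
        = ∫⁻ x, liminf (fun m => ENNReal.ofReal
            (posPart V x * ((u n).fn x - (u (k m)).fn x) ^ 2)) atTop := by
          refine lintegral_congr_ae ?_
          filter_upwards [hae] with x hx
          exact (Tendsto.liminf_eq (ENNReal.tendsto_ofReal
            (((tendsto_const_nhds.sub hx).pow 2).const_mul _))).symm
      _ ≤ liminf (fun m => ∫⁻ x, ENNReal.ofReal
            (posPart V x * ((u n).fn x - (u (k m)).fn x) ^ 2)) atTop := by
          refine lintegral_liminf_le' fun m => ?_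
          exact ((continuous_posPart V).measurable.aemeasurable.mul
            (((Lp.aestronglyMeasurable _).aemeasurable.sub
              (Lp.aestronglyMeasurable _).aemeasurable).pow_const 2)).ennreal_ofReal
      _ ≤ liminf (fun _ => ENNReal.ofReal (ε ^ 2)) atTop := by
          refine liminf_le_liminf ?_
          filter_upwards [eventually_ge_atTop N] with m hm
          have h1 := lintegral_pot (u n - u (k m))
          refine le_trans (le_of_eq ?_) (h1.trans (ENNReal.ofReal_le_ofReal ?_))
          · refine lintegral_congr_ae ?_
            filter_upwards [fn_sub_ae (u n) (u (k m))] with x hx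
            rw [hx]
          · have := hN n hn (k m) (hm.trans (hk.id_le m))
            rw [dist_eq_norm] at this
            gcongr
      _ = ENNReal.ofReal (ε ^ 2) := liminf_const _
  have hint : ∀ n, (∫⁻ x, ENNReal.ofReal (posPart V x * ((u n).fn x - v x) ^ 2)) ≠ ⊤ →
      Integrable (fun x => posPart V x * ((u n).fn x - v x) ^ 2) := by
    intro n hn
    refine ⟨(continuous_posPart V).aestronglyMeasurable.mul
      (((Lp.aestronglyMeasurable _).sub (Lp.aestronglyMeasurable _)).pow 2), ?_⟩
    rw [hasFiniteIntegral_iff_ofReal (Eventually.of_forall fun x =>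
      mul_nonneg (posPart_nonneg V x) (sq_nonneg _))]
    exact hn.lt_top
  have hae_sub : ∀ n, (((u n).fn - v : Lp ℝ 2 (volume : Measure R3)) : R3 → ℝ)
      =ᵐ[volume] fun x => (u n).fn x - v x := fun n => Lp.coeFn_sub _ _
  -- Fatou controls differences only, so the limit enters `E` as `u N - (u N - v)`.
  obtain ⟨N, hN⟩ := hfatou 1 one_pos
  have hd : ((u N).fn - v, (u N).grad - K) ∈ energySubmodule a V := by
    refine ⟨sobolevH1.sub_mem (x := ((u N).fn, (u N).grad)) (y := (v, K)) (u N).isWeakGradient hvK,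
      (integrable_energy_iff _ _ _).2 ?_⟩
    refine (hint N (ne_top_of_le_ne_top ENNReal.ofReal_ne_top (hN N le_rfl))).congr ?_
    filter_upwards [hae_sub N] with x hx
    rw [hx]
  let w : EnergySpace a ha V := u N - ⟨_, hd⟩
  have hwf : w.fn = v := sub_sub_cancel _ _
  have hwg : w.grad = K := sub_sub_cancel _ _
  refine ⟨w, ?_⟩
  rw [tendsto_iff_norm_sub_tendsto_zero]
  have hsq : Tendsto (fun n => ‖u n - w‖ ^ 2) atTop (𝓝 0) := by
    have hg : Tendsto (fun n => a * ‖(u n - w).grad‖ ^ 2) atTop (𝓝 0) := by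
      have h1 := ((tendsto_iff_norm_sub_tendsto_zero.1 hK).pow 2).const_mul a
      simp only [ne_eq, OfNat.ofNat_ne_zero, not_false_eq_true, zero_pow, mul_zero] at h1
      refine h1.congr fun n => ?_
      rw [grad_sub, hwg]
    have hp : Tendsto (fun n => ∫ x, posPart V x * (u n - w).fn x ^ 2) atTop (𝓝 0) := by
      rw [Metric.tendsto_atTop]
      intro ε hε
      obtain ⟨N, hN⟩ := hfatou (Real.sqrt (ε / 2)) (by positivity)
      refine ⟨N, fun n hn => ?_⟩
      rw [Real.dist_eq, sub_zero, abs_of_nonneg (integral_pot_nonneg _),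
        integral_eq_lintegral_of_nonneg_ae (Eventually.of_forall fun x =>
          mul_nonneg (posPart_nonneg V x) (sq_nonneg _)) (integrable_pot _).1]
      have h2 := hN n hn
      rw [Real.sq_sqrt (by positivity)] at h2
      refine lt_of_le_of_lt (ENNReal.toReal_le_of_le_ofReal (b := ε / 2) (by positivity)
        (le_trans (le_of_eq ?_) h2)) (by linarith)
      refine lintegral_congr_ae ?_
      filter_upwards [fn_sub_ae (u n) w] with x hx
      rw [hx, hwf]
    simpa only [norm_sq_eq, add_zero] using hg.add hp
  have h3 := (Real.continuous_sqrt.tendsto 0).comp hsq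
  simpa only [Function.comp_def, Real.sqrt_zero, Real.sqrt_sq (norm_nonneg _)] using h3

end EnergySpace

/-- The negative part `V⁻ = max (-V, 0)`. -/
def negPart (V : R3 → ℝ) (x : R3) : ℝ := max (-V x) 0

lemma negPart_nonneg (V : R3 → ℝ) (x : R3) : 0 ≤ negPart V x := le_max_right _ _

lemma continuous_negPart (V : C(R3, ℝ)) : Continuous (negPart V) :=
  V.continuous.neg.max continuous_const

lemma posPart_sub_negPart (V : R3 → ℝ) (x : R3) : posPart V x - negPart V x = V x := by
  unfold posPart negPart
  rcases le_total (V x) 0 with h | h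
  · rw [max_eq_right h, max_eq_left (by linarith)]; ring
  · rw [max_eq_left h, max_eq_right (by linarith)]; ring

lemma CondV1.exists_negPart_le {V : C(R3, ℝ)} (hV : CondV1 V) :
    ∃ m : ℝ, 0 ≤ m ∧ ∀ x, negPart V x ≤ m := by
  obtain ⟨⟨m, hm⟩, -⟩ := hV
  exact ⟨max (-m) 0, le_max_right _ _, fun x => max_le_max_right _ (neg_le_neg (hm x))⟩

lemma integrable_negPart_mul {V : C(R3, ℝ)} (hV : CondV1 V) {g : R3 → ℝ} (hg : Integrable g) :
    Integrable (fun x => negPart V x * g x) := by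
  obtain ⟨m, -, hm⟩ := hV.exists_negPart_le
  refine hg.bdd_mul (c := m) (continuous_negPart V).aestronglyMeasurable
    (Eventually.of_forall fun x => ?_)
  rw [Real.norm_of_nonneg (negPart_nonneg V x)]
  exact hm x

namespace EnergySpace

variable {a : ℝ} {ha : 0 < a} {V : C(R3, ℝ)}

/-- The negative part of the potential is a compact perturbation: up to a small multiple of the
energy it only sees a ball. -/
lemma exists_integral_negPart_le (hV : CondV1 V) {ε : ℝ} (hε : 0 < ε) :
    ∃ R L : ℝ, 0 ≤ L ∧ ∀ u : EnergySpace a ha V, ∫ x, negPart V x * u.fn x ^ 2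
      ≤ ε * ‖u‖ ^ 2 + L * ∫ x in Metric.closedBall 0 R, u.fn x ^ 2 := by
  obtain ⟨m, hm0, hm⟩ := hV.exists_negPart_le
  obtain ⟨S, hS, h6⟩ := exists_eLpNorm_six_le a ha V
  obtain ⟨-, M, hM, -, hfin⟩ := hV
  let A : Set R3 := {x | posPart V x < M}
  have hAm : MeasurableSet A := (isOpen_lt (continuous_posPart V) continuous_const).measurableSet
  -- `V⁻` vanishes off `A`, and the tails of `A` outside balls have measure tending to zero. The
  -- radius is chosen so that Hölder on the tail costs less than `ε`.
  let T : ℕ → Set R3 := fun n => A \ Metric.closedBall 0 n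
  have hT : Tendsto (fun n => volume (T n)) atTop (𝓝 0) := by
    have h1 := tendsto_measure_iInter_atTop (μ := (volume : Measure R3)) (s := T)
      (fun n => (hAm.diff measurableSet_closedBall).nullMeasurableSet)
      (fun i j hij => Set.sdiff_subset_sdiff_right
        (Metric.closedBall_subset_closedBall (Nat.cast_le.2 hij)))
      ⟨0, (measure_mono Set.sdiff_subset |>.trans_lt hfin).ne⟩
    have h2 : ⋂ n, T n = ∅ := by
      ext x
      simp only [T, Set.mem_iInter, Set.mem_sdiff, mem_closedBall_zero_iff, Set.mem_empty_iff_false,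
        iff_false, not_forall]
      obtain ⟨n, hn⟩ := exists_nat_gt ‖x‖
      exact ⟨n, fun h => h.2 hn.le⟩
    rwa [h2, measure_empty] at h1
  have hT2 : Tendsto (fun n => m * (S ^ 2 * ((volume (T n)).toReal ^ (1 / 3 : ℝ)) ^ 2)) atTop
      (𝓝 0) := by
    have h1 := ((((Real.continuous_rpow_const (q := 1 / 3) (by norm_num)).tendsto _).comp
      ((ENNReal.tendsto_toReal ENNReal.zero_ne_top).comp hT)).pow 2).const_mul (S ^ 2) |>.const_mul m
    simpa using h1
  obtain ⟨n, hn⟩ := (hT2.eventually (gt_mem_nhds hε)).exists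
  refine ⟨n, m, hm0, fun u => ?_⟩
  have hi := u.integrable_fn_sq
  have hpt : ∀ x, negPart V x * u.fn x ^ 2 ≤ m * (T n).indicator (fun x => u.fn x ^ 2) x
      + m * (Metric.closedBall (0 : R3) n).indicator (fun x => u.fn x ^ 2) x := by
    intro x
    have h0 : ∀ s : Set R3, 0 ≤ m * s.indicator (fun x => u.fn x ^ 2) x := fun s =>
      mul_nonneg hm0 (Set.indicator_nonneg (fun _ _ => sq_nonneg _) _)
    have h1 : negPart V x * u.fn x ^ 2 ≤ m * u.fn x ^ 2 :=
      mul_le_mul_of_nonneg_right (hm x) (sq_nonneg _)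
    by_cases hx : x ∈ Metric.closedBall (0 : R3) n
    · rw [Set.indicator_of_mem hx]
      linarith [h0 (T n)]
    · by_cases hxA : x ∈ A
      · rw [Set.indicator_of_mem (show x ∈ T n from ⟨hxA, hx⟩)]
        linarith [h0 (Metric.closedBall 0 n)]
      · have h2 : negPart V x = 0 := by
          have : M ≤ posPart V x := not_lt.1 hxA
          unfold posPart at this
          have h3 : 0 < V x := by
            by_contra h
            rw [max_eq_right (not_lt.1 h)] at this
            linarith
          exact max_eq_right (by linarith)
        rw [h2, zero_mul]
        exact add_nonneg (h0 _) (h0 _)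
  have hTm : MeasurableSet (T n) := hAm.diff measurableSet_closedBall
  calc ∫ x, negPart V x * u.fn x ^ 2
      ≤ ∫ x, (m * (T n).indicator (fun x => u.fn x ^ 2) x
        + m * (Metric.closedBall (0 : R3) n).indicator (fun x => u.fn x ^ 2) x) := by
        refine integral_mono_of_nonneg (Eventually.of_forall fun x =>
          mul_nonneg (negPart_nonneg V x) (sq_nonneg _)) ?_ (Eventually.of_forall hpt)
        exact ((hi.indicator hTm).const_mul m).add
          ((hi.indicator measurableSet_closedBall).const_mul m)
    _ = m * (∫ x in T n, u.fn x ^ 2) + m * ∫ x in Metric.closedBall 0 (n : ℝ), u.fn x ^ 2 := by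
        rw [integral_add ((hi.indicator hTm).const_mul m)
          ((hi.indicator measurableSet_closedBall).const_mul m), integral_const_mul,
          integral_const_mul, integral_indicator hTm, integral_indicator measurableSet_closedBall]
    _ ≤ _ := by
        refine add_le_add ?_ le_rfl
        have h1 := mul_le_mul_of_nonneg_left (setIntegral_sq_le hS (h6 u)
          (s := T n) (measure_mono Set.sdiff_subset |>.trans_lt hfin).ne) hm0
        refine h1.trans ?_
        have h2 := mul_le_mul_of_nonneg_right hn.le (sq_nonneg ‖u‖)
        linarith

end EnergySpace

end

/-! ### Pointwise estimates for the nonlinearity and its primitive. -/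

section

variable {f : R3 → ℝ → ℝ} {p : ℝ}

lemma CondF2.map_zero (hf2 : CondF2 f) (x : R3) : f x 0 = 0 := by
  obtain ⟨δ, hδ, h⟩ := hf2.1 1 one_pos
  simpa using h x 0 (by simpa using hδ)

lemma CondF1.continuous (hf1 : CondF1 f p) : Continuous (fun z : R3 × ℝ => f z.1 z.2) :=
  hf1.1.continuous

lemma CondF1.continuous_right (hf1 : CondF1 f p) (x : R3) : Continuous (f x) :=
  hf1.continuous.comp (Continuous.prodMk_right x)

/-- Subcritical growth: beyond a large level, `f` is dominated by a small multiple of the critical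
power. -/
lemma CondF1.exists_level (hf1 : CondF1 f p) {ε : ℝ} (hε : 0 < ε) :
    ∃ l : ℝ, 1 ≤ l ∧ ∀ r, l ≤ r → ∀ x s, |s| ≤ r → |f x s| ≤ ε * r ^ 5 := by
  obtain ⟨-, hp2, hp6, c, hc, hf⟩ := hf1
  -- The quotient of `r ^ 5` by `r ^ (p - 1)` is `r ^ (6 - p)`, which tends to infinity. The factor
  -- 2 absorbs the constant term of the growth bound when `r ≥ 1`.
  have h1 := (tendsto_rpow_atTop (show 0 < 6 - p by linarith)).eventually_ge_atTop (2 * c / ε)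
  obtain ⟨l, hl⟩ := eventually_atTop.1 h1
  refine ⟨max l 1, le_max_right _ _, fun r hr x s hs => ?_⟩
  have hr1 : 1 ≤ r := (le_max_right _ _).trans hr
  have hr0 : 0 < r := by linarith
  have h2 := hl r ((le_max_left _ _).trans hr)
  rw [div_le_iff₀ hε] at h2
  have h3 : |s| ^ (p - 1) ≤ r ^ (p - 1) := Real.rpow_le_rpow (abs_nonneg _) hs (by linarith)
  have h4 : 1 ≤ r ^ (p - 1) := Real.one_le_rpow hr1 (by linarith)
  have h5 : r ^ 5 = r ^ (p - 1) * r ^ (6 - p) := by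
    rw [← Real.rpow_add hr0, ← Real.rpow_natCast]; norm_num
  calc |f x s| ≤ c * (1 + |s| ^ (p - 1)) := hf x s
    _ ≤ c * (r ^ (p - 1) + r ^ (p - 1)) := by gcongr
    _ = r ^ (p - 1) * (2 * c) := by ring
    _ ≤ r ^ (p - 1) * (r ^ (6 - p) * ε) := by gcongr
    _ = ε * r ^ 5 := by rw [h5]; ring

lemma CondF1.exists_lipschitz (hf1 : CondF1 f p) (R l : ℝ) :
    ∃ L : ℝ, 0 ≤ L ∧ ∀ x ∈ Metric.closedBall (0 : R3) R, ∀ t s, |t| ≤ l → |s| ≤ l →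
      |f x t - f x s| ≤ L * |t - s| := by
  set g : R3 × ℝ → ℝ := fun z => f z.1 z.2
  have hg : ContDiff ℝ 1 g := hf1.1
  let K : Set (R3 × ℝ) := Metric.closedBall (0 : R3) R ×ˢ Metric.closedBall (0 : ℝ) l
  have hK : IsCompact K := (isCompact_closedBall _ _).prod (isCompact_closedBall _ _)
  have hKc : Convex ℝ K := (convex_closedBall _ _).prod (convex_closedBall _ _)
  obtain ⟨L, hL⟩ := hK.exists_bound_of_continuousOn (hg.continuous_fderiv one_ne_zero).continuousOn
  refine ⟨max L 0, le_max_right _ _, fun x hx t s ht hs => ?_⟩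
  have h1 := hKc.norm_image_sub_le_of_norm_fderiv_le (f := g) (x := (x, s)) (y := (x, t))
    (fun z _ => hg.differentiable one_ne_zero z) (fun z hz => (hL z hz).trans (le_max_left L 0))
    ⟨hx, by simpa using hs⟩ ⟨hx, by simpa using ht⟩
  simpa [g, Prod.norm_def] using h1

/-- Uniform modulus of continuity of `f`: away from a ball and from the Lipschitz regime, only
a small multiple of the linear and critical terms remains. -/
lemma exists_modulus (hf1 : CondF1 f p) (hf2 : CondF2 f) (hf4 : CondF4 f) {ε : ℝ} (hε : 0 < ε) :
    ∃ R L : ℝ, 0 ≤ L ∧ ∀ x t s, |f x t - f x s| ≤ ε * (|t| + |s| + |t| ^ 5 + |s| ^ 5)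
      + (Metric.closedBall (0 : R3) R).indicator (fun _ => L) x * |t - s| := by
  -- Subcritical growth fixes the level `l`, (f4) at that level fixes `R`, and the Lipschitz
  -- constant is taken on the remaining compact set. The three regimes are: both arguments below `l`
  -- inside the ball, both below `l` outside it, and one above `l`.
  obtain ⟨l, hl1, hl⟩ := hf1.exists_level (half_pos hε)
  obtain ⟨R, hR⟩ := hf4 l (by linarith) ε hε
  obtain ⟨L, hL0, hL⟩ := hf1.exists_lipschitz R l
  refine ⟨R, L, hL0, fun x t s => ?_⟩
  have hI : 0 ≤ (Metric.closedBall (0 : R3) R).indicator (fun _ => L) x * |t - s| :=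
    mul_nonneg (Set.indicator_nonneg (fun _ _ => hL0) _) (abs_nonneg _)
  have ht0 := abs_nonneg t
  have hs0 := abs_nonneg s
  have ht5 : 0 ≤ |t| ^ 5 := by positivity
  have hs5 : 0 ≤ |s| ^ 5 := by positivity
  by_cases hts : |t| ≤ l ∧ |s| ≤ l
  · by_cases hx : x ∈ Metric.closedBall (0 : R3) R
    · rw [Set.indicator_of_mem hx]
      have : 0 ≤ ε * (|t| + |s| + |t| ^ 5 + |s| ^ 5) := by positivity
      linarith [hL x hx t s hts.1 hts.2]
    · have hx' : R ≤ ‖x‖ := by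
        rw [mem_closedBall_zero_iff, not_le] at hx; exact hx.le
      have key : ∀ r, |r| ≤ l → |f x r| ≤ ε * |r| := by
        intro r hr
        rcases eq_or_ne r 0 with rfl | h0
        · simp [hf2.map_zero]
        · have := hR x hx' r h0 hr
          rwa [div_le_iff₀ (abs_pos.2 h0)] at this
      calc |f x t - f x s| ≤ |f x t| + |f x s| := abs_sub _ _
        _ ≤ ε * |t| + ε * |s| := add_le_add (key t hts.1) (key s hts.2)
        _ ≤ ε * (|t| + |s| + |t| ^ 5 + |s| ^ 5) := by
          rw [← mul_add]; exact mul_le_mul_of_nonneg_left (by linarith) hε.le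
        _ ≤ _ := le_add_of_nonneg_right hI
  · have hm : l ≤ max |t| |s| := by
      rw [not_and_or, not_le, not_le] at hts
      exact le_max_iff.2 (hts.imp le_of_lt le_of_lt)
    calc |f x t - f x s| ≤ |f x t| + |f x s| := abs_sub _ _
      _ ≤ ε / 2 * max |t| |s| ^ 5 + ε / 2 * max |t| |s| ^ 5 :=
        add_le_add (hl _ hm x t (le_max_left _ _)) (hl _ hm x s (le_max_right _ _))
      _ = ε * max |t| |s| ^ 5 := by ring
      _ ≤ ε * (|t| + |s| + |t| ^ 5 + |s| ^ 5) := by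
        gcongr
        rcases max_choice |t| |s| with h | h <;> rw [h] <;> linarith
      _ ≤ _ := le_add_of_nonneg_right hI

/-- The modulus at `s = 0`, where `f x 0 = 0` by (f2). -/
lemma exists_growth (hf1 : CondF1 f p) (hf2 : CondF2 f) (hf4 : CondF4 f) :
    ∃ C : ℝ, 0 ≤ C ∧ ∀ x t, |f x t| ≤ C * (|t| + |t| ^ 5) := by
  obtain ⟨R, L, hL, h⟩ := exists_modulus hf1 hf2 hf4 one_pos
  refine ⟨1 + L, by positivity, fun x t => ?_⟩
  have h1 := h x t 0
  simp only [hf2.map_zero, sub_zero, abs_zero, add_zero, one_mul, ne_eq, OfNat.ofNat_ne_zero,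
    not_false_eq_true, zero_pow] at h1
  have h2 : (Metric.closedBall (0 : R3) R).indicator (fun _ => L) x ≤ L :=
    Set.indicator_le_self' (fun _ _ => hL) x
  have h3 := mul_le_mul_of_nonneg_right h2 (abs_nonneg t)
  have h4 : 0 ≤ L * |t| ^ 5 := by positivity
  linarith

lemma CondF1.continuous_primitive (hf1 : CondF1 f p) :
    Continuous (fun z : R3 × ℝ => primitive f z.1 z.2) := by
  refine intervalIntegral.continuous_parametric_intervalIntegral_of_continuous
    (f := fun (z : R3 × ℝ) s => f z.1 s) (s := fun z => z.2) ?_ continuous_snd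
  exact hf1.continuous.comp ((continuous_fst.comp continuous_fst).prodMk continuous_snd)

lemma primitive_zero (x : R3) : primitive f x 0 = 0 := intervalIntegral.integral_same

lemma abs_primitive_le {C : ℝ} (hC : 0 ≤ C)
    (h : ∀ x t, |f x t| ≤ C * (|t| + |t| ^ 5)) (x : R3) (t : ℝ) :
    |primitive f x t| ≤ C * (|t| + |t| ^ 5) * |t| := by
  have h1 := intervalIntegral.norm_integral_le_of_norm_le_const (a := 0) (b := t) (f := f x)
    (C := C * (|t| + |t| ^ 5)) (fun s hs => ?_)
  · simpa [primitive] using h1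
  · refine (h x s).trans ?_
    have : |s| ≤ |t| := by
      have := Set.abs_sub_left_of_mem_uIcc (Set.uIoc_subset_uIcc hs)
      simpa using this
    gcongr

/-- The remainder is the integral of `f x s - f x t` over an interval of length `|r|`. Convexity
gives `|s| ^ 5 ≤ 16 * (|t| ^ 5 + |r| ^ 5)` there, and the additional `|t| ^ 5` makes 17. The
indicator can be dropped because its term is already quadratic in `r`. -/
lemma abs_primitive_add_sub_le (hf1 : CondF1 f p) {ε R L : ℝ} (hε : 0 ≤ ε) (hL : 0 ≤ L)
    (h : ∀ x t s, |f x t - f x s| ≤ ε * (|t| + |s| + |t| ^ 5 + |s| ^ 5)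
      + (Metric.closedBall (0 : R3) R).indicator (fun _ => L) x * |t - s|) (x : R3) (t r : ℝ) :
    |primitive f x (t + r) - primitive f x t - f x t * r|
      ≤ 17 * ε * ((|t| + |r| + |t| ^ 5 + |r| ^ 5) * |r|) + L * (|r| * |r|) := by
  have hi : ∀ c d : ℝ, IntervalIntegrable (f x) volume c d := fun c d =>
    (hf1.continuous_right x).intervalIntegrable c d
  have e : primitive f x (t + r) - primitive f x t - f x t * r
      = ∫ s in t..(t + r), (f x s - f x t) := by
    rw [intervalIntegral.integral_sub (hi _ _) intervalIntegrable_const,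
      intervalIntegral.integral_const, primitive, primitive,
      intervalIntegral.integral_interval_sub_left (hi _ _) (hi _ _)]
    simp [mul_comm]
  rw [e]
  have h1 := intervalIntegral.norm_integral_le_of_norm_le_const (a := t) (b := t + r)
    (f := fun s => f x s - f x t)
    (C := 17 * ε * (|t| + |r| + |t| ^ 5 + |r| ^ 5) + L * |r|) (fun s hs => ?_)
  · rw [add_sub_cancel_left, Real.norm_eq_abs] at h1
    exact h1.trans_eq (by ring)
  · have hst : |s - t| ≤ |r| := by
      have := Set.abs_sub_left_of_mem_uIcc (Set.uIoc_subset_uIcc hs)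
      simpa using this
    have hs' : |s| ≤ |t| + |r| := by
      have := abs_add_le t (s - t)
      rw [add_sub_cancel] at this
      linarith
    have hs5 : |s| ^ 5 ≤ 16 * (|t| ^ 5 + |r| ^ 5) := by
      have h2 := add_pow_le (abs_nonneg t) (abs_nonneg r) 5
      have h3 : |s| ^ 5 ≤ (|t| + |r|) ^ 5 := by gcongr
      norm_num at h2
      linarith
    have hI : (Metric.closedBall (0 : R3) R).indicator (fun _ => L) x ≤ L :=
      Set.indicator_le_self' (fun _ _ => hL) x
    rw [Real.norm_eq_abs]
    refine (h x s t).trans (add_le_add ?_ ?_)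
    · rw [mul_comm (17 : ℝ), mul_assoc]
      refine mul_le_mul_of_nonneg_left ?_ hε
      have ht0 := abs_nonneg t
      have hr0 := abs_nonneg r
      have ht5 : 0 ≤ |t| ^ 5 := by positivity
      have hr5 : 0 ≤ |r| ^ 5 := by positivity
      linarith
    · exact mul_le_mul hI hst (abs_nonneg _) hL

lemma CondF3.primitive_nonneg (hf3 : CondF3 f p) (x : R3) (t : ℝ) : 0 ≤ primitive f x t := by
  obtain ⟨a₀, b₀, α, ha₀, hb₀, -, -, h⟩ := hf3
  rcases eq_or_ne t 0 with rfl | ht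
  · rw [primitive_zero]
  · have h1 : 0 < 4 + 1 / (a₀ * |t| ^ α + b₀) := by positivity
    exact (pos_of_mul_pos_right (h x t ht).1 h1.le).le

/-- Discarding the nonnegative extra term of (f3) leaves the factor 4, which matches the degree of
the Kirchhoff term. -/
lemma CondF3.four_primitive_le (hf3 : CondF3 f p) (x : R3) (t : ℝ) :
    4 * primitive f x t ≤ f x t * t := by
  have hF := hf3.primitive_nonneg x t
  obtain ⟨a₀, b₀, α, ha₀, hb₀, -, -, h⟩ := hf3
  rcases eq_or_ne t 0 with rfl | ht
  · simp [primitive_zero]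
  · have h1 : 0 ≤ 1 / (a₀ * |t| ^ α + b₀) := by positivity
    have h2 := (h x t ht).2
    rw [add_mul] at h2
    nlinarith [mul_nonneg h1 hF]

end

/-! ### Integral estimates and differentiability of `u ↦ ∫ F(x, u)`. -/

section

/-- Hölder with exponents `(k + 1) / k` and `k + 1`; the cases `k = 1` and `k = 5` correspond to
`L²` and `L⁶`. -/
lemma integral_pow_mul_le {k : ℕ} (hk : k ≠ 0) {u v : R3 → ℝ}
    (hum : AEStronglyMeasurable u volume) (hvm : AEStronglyMeasurable v volume) {A B : ℝ}
    (hA : 0 ≤ A) (hB : 0 ≤ B) (hu : eLpNorm u (k + 1 : ℕ) volume ≤ ENNReal.ofReal A)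
    (hv : eLpNorm v (k + 1 : ℕ) volume ≤ ENNReal.ofReal B) :
    Integrable (fun x => |u x| ^ k * |v x|) ∧ ∫ x, |u x| ^ k * |v x| ≤ A ^ k * B := by
  have hk0 : (0 : ℝ) < k := by positivity
  have e : ∀ {w : R3 → ℝ}, eLpNorm w (k + 1 : ℕ) volume
      = (∫⁻ x, ‖w x‖ₑ ^ ((k + 1 : ℕ) : ℝ)) ^ (1 / ((k + 1 : ℕ) : ℝ)) := fun {w} => by
    rw [eLpNorm_eq_lintegral_rpow_enorm_toReal (by simp) (by simp), ENNReal.toReal_natCast]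
  have key : ∫⁻ x, ‖|u x| ^ k * |v x|‖ₑ ≤ ENNReal.ofReal (A ^ k * B) := by
    have h1 := ENNReal.lintegral_mul_le_Lp_mul_Lq (volume : Measure R3)
      (p := (k + 1 : ℕ) / k) (q := (k + 1 : ℕ))
      (Real.holderConjugate_iff.2 ⟨by rw [lt_div_iff₀ hk0]; push_cast; linarith, by
        push_cast; field_simp⟩)
      (f := fun x => ‖u x‖ₑ ^ k) (g := fun x => ‖v x‖ₑ) (hum.enorm.pow_const k) hvm.enorm
    rw [← e] at h1
    have h2 : ∀ x, (‖u x‖ₑ ^ k) ^ (((k + 1 : ℕ) : ℝ) / k) = ‖u x‖ₑ ^ ((k + 1 : ℕ) : ℝ) := fun x => by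
      rw [← ENNReal.rpow_natCast_mul, mul_div_cancel₀ _ hk0.ne']
    have h3 : (∫⁻ x, ‖u x‖ₑ ^ ((k + 1 : ℕ) : ℝ)) ^ (1 / (((k + 1 : ℕ) : ℝ) / k))
        = eLpNorm u (k + 1 : ℕ) volume ^ k := by
      rw [e, ← ENNReal.rpow_mul_natCast]
      congr 1
      field_simp
    simp only [h2, h3] at h1
    calc ∫⁻ x, ‖|u x| ^ k * |v x|‖ₑ = ∫⁻ x, ((fun x => ‖u x‖ₑ ^ k) * fun x => ‖v x‖ₑ) x := by
          refine lintegral_congr fun x => ?_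
          simp [enorm_mul, enorm_pow]
      _ ≤ ENNReal.ofReal A ^ k * ENNReal.ofReal B := h1.trans (by gcongr)
      _ = _ := by rw [ENNReal.ofReal_mul (by positivity), ENNReal.ofReal_pow hA]
  have hm : AEStronglyMeasurable (fun x => |u x| ^ k * |v x|) volume :=
    (hum.norm.pow k).mul hvm.norm
  refine ⟨⟨hm, key.trans_lt ENNReal.ofReal_lt_top⟩, ?_⟩
  rw [integral_eq_lintegral_of_nonneg_ae (Eventually.of_forall fun x => by positivity) hm]
  refine ENNReal.toReal_le_of_le_ofReal (by positivity) (le_trans (le_of_eq ?_) key)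
  refine lintegral_congr fun x => ?_
  rw [← ofReal_norm, Real.norm_of_nonneg (by positivity)]

/-- `S` bounds the embeddings of `E` into `L²` and `L⁶`, and the gradient. -/
def IsEmbeddingConst (a : ℝ) (ha : 0 < a) (V : C(R3, ℝ)) (S : ℝ) : Prop :=
  0 < S ∧ ∀ u : EnergySpace a ha V,
    ‖u.fn‖ ≤ S * ‖u‖ ∧ eLpNorm u.fn 6 volume ≤ ENNReal.ofReal (S * ‖u‖) ∧ ‖u.grad‖ ≤ S * ‖u‖

variable {a : ℝ} {ha : 0 < a} {V : C(R3, ℝ)} {S : ℝ} {f : R3 → ℝ → ℝ} {p : ℝ}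

namespace IsEmbeddingConst

lemma linear (hS : IsEmbeddingConst a ha V S) (u v : EnergySpace a ha V) :
    Integrable (fun x => |u.fn x| * |v.fn x|) ∧
      ∫ x, |u.fn x| * |v.fn x| ≤ (S * ‖u‖) * (S * ‖v‖) := by
  have h0 := hS.1.le
  have h2 : ∀ u : EnergySpace a ha V, eLpNorm u.fn (1 + 1 : ℕ) volume ≤ ENNReal.ofReal (S * ‖u‖) := by
    intro u
    have : ((1 + 1 : ℕ) : ℝ≥0∞) = 2 := by norm_num
    rw [this, ← Lp.enorm_def, ← ofReal_norm]
    exact ENNReal.ofReal_le_ofReal (hS.2 u).1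
  have := integral_pow_mul_le one_ne_zero (Lp.aestronglyMeasurable u.fn)
    (Lp.aestronglyMeasurable v.fn) (by positivity) (by positivity) (h2 u) (h2 v)
  simpa only [pow_one] using this

lemma critical (hS : IsEmbeddingConst a ha V S) (u v : EnergySpace a ha V) :
    Integrable (fun x => |u.fn x| ^ 5 * |v.fn x|) ∧
      ∫ x, |u.fn x| ^ 5 * |v.fn x| ≤ (S * ‖u‖) ^ 5 * (S * ‖v‖) := by
  have h0 := hS.1.le
  have e : ((5 + 1 : ℕ) : ℝ≥0∞) = 6 := by norm_num
  exact integral_pow_mul_le (by norm_num) (Lp.aestronglyMeasurable u.fn)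
    (Lp.aestronglyMeasurable v.fn) (by positivity) (by positivity)
    (by rw [e]; exact (hS.2 u).2.1) (by rw [e]; exact (hS.2 v).2.1)

lemma mixed (hS : IsEmbeddingConst a ha V S) (u w v : EnergySpace a ha V) :
    Integrable (fun x => (|u.fn x| + |w.fn x| + |u.fn x| ^ 5 + |w.fn x| ^ 5) * |v.fn x|) ∧
      ∫ x, (|u.fn x| + |w.fn x| + |u.fn x| ^ 5 + |w.fn x| ^ 5) * |v.fn x|
        ≤ (S * ‖u‖ + S * ‖w‖ + (S * ‖u‖) ^ 5 + (S * ‖w‖) ^ 5) * (S * ‖v‖) := by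
  obtain ⟨i1, l1⟩ := hS.linear u v
  obtain ⟨i2, l2⟩ := hS.linear w v
  obtain ⟨i3, l3⟩ := hS.critical u v
  obtain ⟨i4, l4⟩ := hS.critical w v
  simp only [add_mul]
  have i12 : Integrable (fun x => |u.fn x| * |v.fn x| + |w.fn x| * |v.fn x|) := i1.add i2
  have i123 : Integrable (fun x => |u.fn x| * |v.fn x| + |w.fn x| * |v.fn x|
    + |u.fn x| ^ 5 * |v.fn x|) := i12.add i3
  refine ⟨i123.add i4, ?_⟩
  rw [integral_add i123 i4, integral_add i12 i3, integral_add i1 i2]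
  linarith

end IsEmbeddingConst

lemma aestronglyMeasurable_comp {g : R3 → ℝ → ℝ}
    (hg : Continuous (fun z : R3 × ℝ => g z.1 z.2)) {u : R3 → ℝ}
    (hu : AEStronglyMeasurable u volume) : AEStronglyMeasurable (fun x => g x (u x)) volume :=
  hg.comp_aestronglyMeasurable (aestronglyMeasurable_id.prodMk hu)

lemma integrable_nonlinearity_mul (hS : IsEmbeddingConst a ha V S) (hf1 : CondF1 f p)
    (hf2 : CondF2 f) (hf4 : CondF4 f) (u v : EnergySpace a ha V) :
    Integrable (fun x => f x (u.fn x) * v.fn x) := by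
  obtain ⟨C, hC, h⟩ := exists_growth hf1 hf2 hf4
  refine (((hS.linear u v).1.add (hS.critical u v).1).const_mul C).mono'
    ((aestronglyMeasurable_comp hf1.continuous (Lp.aestronglyMeasurable _)).mul
      (Lp.aestronglyMeasurable _)) (Eventually.of_forall fun x => ?_)
  rw [Real.norm_eq_abs, abs_mul, Pi.add_apply, ← add_mul, ← mul_assoc]
  exact mul_le_mul_of_nonneg_right (h x _) (abs_nonneg _)

lemma integrable_primitive (hS : IsEmbeddingConst a ha V S) (hf1 : CondF1 f p)
    (hf2 : CondF2 f) (hf4 : CondF4 f) (u : EnergySpace a ha V) :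
    Integrable (fun x => primitive f x (u.fn x)) := by
  obtain ⟨C, hC, h⟩ := exists_growth hf1 hf2 hf4
  refine (((hS.linear u u).1.add (hS.critical u u).1).const_mul C).mono'
    (aestronglyMeasurable_comp hf1.continuous_primitive (Lp.aestronglyMeasurable _))
      (Eventually.of_forall fun x => ?_)
  rw [Real.norm_eq_abs, Pi.add_apply, ← add_mul, ← mul_assoc]
  exact abs_primitive_le hC h x _

/-- The nonlinearity `u ↦ f(·, u)` is continuous from `L²_loc` to `E*` on bounded sets. -/
lemma exists_nonlinearity_sub_le (hS : IsEmbeddingConst a ha V S) (hf1 : CondF1 f p)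
    (hf2 : CondF2 f) (hf4 : CondF4 f) {ε : ℝ} (hε : 0 < ε) :
    ∃ R L : ℝ, 0 ≤ L ∧ ∀ u w v : EnergySpace a ha V,
      |(∫ x, f x (u.fn x) * v.fn x) - ∫ x, f x (w.fn x) * v.fn x|
        ≤ ε * ((S * ‖u‖ + S * ‖w‖ + (S * ‖u‖) ^ 5 + (S * ‖w‖) ^ 5) * (S * ‖v‖))
          + L * ∫ x in Metric.closedBall 0 R, |(u - w).fn x| * |v.fn x| := by
  obtain ⟨R, L, hL, h⟩ := exists_modulus hf1 hf2 hf4 hε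
  refine ⟨R, L, hL, fun u w v => ?_⟩
  obtain ⟨i1, l1⟩ := hS.mixed u w v
  have i2 := (hS.linear (u - w) v).1
  have i3 := i2.indicator (s := Metric.closedBall (0 : R3) R) measurableSet_closedBall
  rw [← integral_sub (integrable_nonlinearity_mul hS hf1 hf2 hf4 u v)
    (integrable_nonlinearity_mul hS hf1 hf2 hf4 w v), ← Real.norm_eq_abs,
    ← integral_indicator measurableSet_closedBall]
  refine le_trans (norm_integral_le_of_norm_le ((i1.const_mul ε).add (i3.const_mul L)) ?_) ?_
  · filter_upwards [EnergySpace.fn_sub_ae u w] with x hx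
    rw [Real.norm_eq_abs, ← sub_mul, abs_mul]
    refine (mul_le_mul_of_nonneg_right (h x _ _) (abs_nonneg _)).trans (le_of_eq ?_)
    by_cases hxR : x ∈ Metric.closedBall (0 : R3) R
    · simp only [Set.indicator_of_mem hxR, Pi.add_apply, hx]; ring
    · simp only [Set.indicator_of_notMem hxR, Pi.add_apply]; ring
  · rw [integral_add' (i1.const_mul ε) (i3.const_mul L), integral_const_mul, integral_const_mul]
    gcongr

/-- The functional `u ↦ ∫ F(x, u)` is continuously differentiable on `E`. -/
lemma exists_hasFDerivAt_primitive (hS : IsEmbeddingConst a ha V S) (hf1 : CondF1 f p)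
    (hf2 : CondF2 f) (hf4 : CondF4 f) :
    ∃ D : EnergySpace a ha V → (EnergySpace a ha V →L[ℝ] ℝ), Continuous D ∧
      (∀ u v, D u v = ∫ x, f x (u.fn x) * v.fn x) ∧
      ∀ u, HasFDerivAt (fun u : EnergySpace a ha V => ∫ x, primitive f x (u.fn x)) (D u) u := by
  have hS0 := hS.1
  have hi := integrable_nonlinearity_mul hS hf1 hf2 hf4
  have hex : ∀ u : EnergySpace a ha V, ∃ D : EnergySpace a ha V →L[ℝ] ℝ,
      ∀ v, D v = ∫ x, f x (u.fn x) * v.fn x := by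
    intro u
    obtain ⟨C, hC, h⟩ := exists_growth hf1 hf2 hf4
    let D₀ : EnergySpace a ha V →ₗ[ℝ] ℝ :=
      { toFun := fun v => ∫ x, f x (u.fn x) * v.fn x
        map_add' := fun v w => by
          rw [← integral_add (hi u v) (hi u w)]
          refine integral_congr_ae ?_
          filter_upwards [EnergySpace.fn_add_ae v w] with x hx
          rw [hx, mul_add]
        map_smul' := fun c v => by
          rw [RingHom.id_apply, smul_eq_mul, ← integral_const_mul]
          refine integral_congr_ae ?_
          filter_upwards [EnergySpace.fn_smul_ae c v] with x hx
          rw [hx]; ring }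
    refine ⟨D₀.mkContinuous (C * (S * ‖u‖ + (S * ‖u‖) ^ 5) * S) fun v => ?_, fun v => rfl⟩
    have i := ((hS.linear u v).1.add (hS.critical u v).1).const_mul C
    refine (norm_integral_le_of_norm_le i (Eventually.of_forall fun x => ?_)).trans ?_
    · rw [Real.norm_eq_abs, abs_mul, Pi.add_apply, ← add_mul, ← mul_assoc]
      exact mul_le_mul_of_nonneg_right (h x _) (abs_nonneg _)
    · rw [integral_const_mul, integral_add' (hS.linear u v).1 (hS.critical u v).1]
      have := mul_le_mul_of_nonneg_left
        (add_le_add (hS.linear u v).2 (hS.critical u v).2) hC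
      linarith
  choose D hD using hex
  refine ⟨D, ?_, hD, fun u => ?_⟩
  · refine (Metric.continuous_iff (α := EnergySpace a ha V)
      (β := EnergySpace a ha V →L[ℝ] ℝ)).2 fun w c hc => ?_
    -- Bounds the growth bracket whenever `‖u‖ ≤ ‖w‖ + 1`, so the first error is at most `c / 4 *
    -- ‖v‖`.
    set B : ℝ := (S * (‖w‖ + 1) + S * ‖w‖ + (S * (‖w‖ + 1)) ^ 5 + (S * ‖w‖) ^ 5) * S with hB
    have hB0 : 0 < B := by positivity
    obtain ⟨R, L, hL, h⟩ := exists_nonlinearity_sub_le hS hf1 hf2 hf4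
      (show 0 < c / (4 * B) by positivity)
    -- This radius makes the local term at most `c / 4 * ‖v‖`; `L + 1` keeps the denominator
    -- positive.
    refine ⟨min 1 (c / (4 * (L + 1) * S ^ 2)), by positivity, fun u hu => ?_⟩
    rw [dist_eq_norm, lt_min_iff] at hu
    obtain ⟨hu1, hu2⟩ := hu
    have hun : ‖u‖ ≤ ‖w‖ + 1 := by
      have := norm_add_le w (u - w)
      rw [add_sub_cancel] at this
      linarith
    refine (dist_eq_norm (D u) (D w)).trans_lt ?_
    refine lt_of_le_of_lt (ContinuousLinearMap.opNorm_le_bound _ (M := c / 2) (by positivity)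
      fun v => ?_) (by linarith)
    rw [sub_apply, hD, hD, Real.norm_eq_abs]
    refine (h u w v).trans ?_
    have h1 : c / (4 * B) * ((S * ‖u‖ + S * ‖w‖ + (S * ‖u‖) ^ 5 + (S * ‖w‖) ^ 5) * (S * ‖v‖))
        ≤ c / 4 * ‖v‖ := by
      calc _ ≤ c / (4 * B) * ((S * (‖w‖ + 1) + S * ‖w‖ + (S * (‖w‖ + 1)) ^ 5 + (S * ‖w‖) ^ 5)
            * (S * ‖v‖)) := by gcongr
        _ = c / (4 * B) * (B * ‖v‖) := by rw [hB]; ring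
        _ = c / 4 * ‖v‖ := by field_simp
    have h2 : L * ∫ x in Metric.closedBall 0 R, |(u - w).fn x| * |v.fn x| ≤ c / 4 * ‖v‖ := by
      obtain ⟨i, l⟩ := hS.linear (u - w) v
      have h3 : ∫ x in Metric.closedBall 0 R, |(u - w).fn x| * |v.fn x|
          ≤ (S * ‖u - w‖) * (S * ‖v‖) := (setIntegral_le_integral i
        (Eventually.of_forall fun x => by positivity)).trans l
      rw [lt_div_iff₀ (by positivity)] at hu2
      calc _ ≤ (L + 1) * ((S * ‖u - w‖) * (S * ‖v‖)) := by
            gcongr; linarith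
        _ = ‖u - w‖ * (4 * (L + 1) * S ^ 2) / 4 * ‖v‖ := by ring
        _ ≤ c / 4 * ‖v‖ := by gcongr
    linarith
  · rw [hasFDerivAt_iff_isLittleO_nhds_zero, Asymptotics.isLittleO_iff]
    intro c hc
    -- For `‖r‖ ≤ 1` the growth part of the remainder is at most `c / (2 * B) * (B * ‖r‖)`. The
    -- other part is quadratic in `r`, and the second constraint on `‖r‖` makes it at most `c / 2 *
    -- ‖r‖`.
    set B : ℝ := 17 * ((S * ‖u‖ + S + (S * ‖u‖) ^ 5 + S ^ 5) * S) with hB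
    have hB0 : 0 < B := by positivity
    obtain ⟨R, L, hL, h⟩ := exists_modulus hf1 hf2 hf4 (show 0 < c / (2 * B) by positivity)
    have hδ : 0 < min 1 (c / (2 * (L + 1) * S ^ 2)) := by positivity
    filter_upwards [Metric.ball_mem_nhds (0 : EnergySpace a ha V) hδ] with r hr
    rw [mem_ball_zero_iff, lt_min_iff] at hr
    obtain ⟨hr1, hr2⟩ := hr
    obtain ⟨i1, l1⟩ := hS.mixed u r r
    obtain ⟨i2, l2⟩ := hS.linear r r
    have hp := integrable_primitive hS hf1 hf2 hf4
    have hpd : Integrable (fun x => primitive f x ((u + r).fn x) - primitive f x (u.fn x)) :=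
      (hp _).sub (hp _)
    rw [hD, ← integral_sub (hp _) (hp _), ← integral_sub hpd (hi u r)]
    refine (norm_integral_le_of_norm_le
      ((i1.const_mul (17 * (c / (2 * B)))).add (i2.const_mul L)) ?_).trans ?_
    · filter_upwards [EnergySpace.fn_add_ae u r] with x hx
      rw [hx]
      exact abs_primitive_add_sub_le hf1 (by positivity) hL h x _ _
    · rw [integral_add' (i1.const_mul _) (i2.const_mul L), integral_const_mul, integral_const_mul]
      have h1 : 17 * (c / (2 * B)) *
          ∫ x, (|u.fn x| + |r.fn x| + |u.fn x| ^ 5 + |r.fn x| ^ 5) * |r.fn x| ≤ c / 2 * ‖r‖ := by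
        have h3 : S * ‖r‖ ≤ S := mul_le_of_le_one_right hS0.le hr1.le
        calc _ ≤ 17 * (c / (2 * B)) *
              ((S * ‖u‖ + S * ‖r‖ + (S * ‖u‖) ^ 5 + (S * ‖r‖) ^ 5) * (S * ‖r‖)) := by gcongr
          _ ≤ 17 * (c / (2 * B)) * ((S * ‖u‖ + S + (S * ‖u‖) ^ 5 + S ^ 5) * (S * ‖r‖)) := by gcongr
          _ = c / (2 * B) * (B * ‖r‖) := by rw [hB]; ring
          _ = c / 2 * ‖r‖ := by field_simp
      have h2 : L * ∫ x, |r.fn x| * |r.fn x| ≤ c / 2 * ‖r‖ := by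
        rw [lt_div_iff₀ (by positivity)] at hr2
        calc _ ≤ (L + 1) * ((S * ‖r‖) * (S * ‖r‖)) := by
              gcongr; linarith
          _ = ‖r‖ * (2 * (L + 1) * S ^ 2) / 2 * ‖r‖ := by ring
          _ ≤ c / 2 * ‖r‖ := by gcongr
      linarith

end

/-! ### The functional is continuously differentiable. -/

section

variable {a b : ℝ} {ha : 0 < a} {V : C(R3, ℝ)} {S : ℝ} {f : R3 → ℝ → ℝ} {p : ℝ}

lemma exists_negPart_form (hV : CondV1 V) (hS : IsEmbeddingConst a ha V S) :
    ∃ B : EnergySpace a ha V →L[ℝ] EnergySpace a ha V →L[ℝ] ℝ,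
      ∀ u v, B u v = ∫ x, negPart V x * (u.fn x * v.fn x) := by
  obtain ⟨m, hm0, hm⟩ := hV.exists_negPart_le
  have hi : ∀ u v : EnergySpace a ha V, Integrable (fun x => negPart V x * (u.fn x * v.fn x)) :=
    fun u v => integrable_negPart_mul hV (memLp_mul_integrable (Lp.memLp _) (Lp.memLp _))
  refine ⟨LinearMap.mkContinuous₂ (LinearMap.mk₂ ℝ
    (fun u v : EnergySpace a ha V => ∫ x, negPart V x * (u.fn x * v.fn x)) ?_ ?_ ?_ ?_)
    (m * S ^ 2) ?_, fun u v => rfl⟩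
  · intro u w v
    rw [← integral_add (hi u v) (hi w v)]
    refine integral_congr_ae ?_
    filter_upwards [EnergySpace.fn_add_ae u w] with x hx
    rw [hx]; ring
  · intro c u v
    rw [smul_eq_mul, ← integral_const_mul]
    refine integral_congr_ae ?_
    filter_upwards [EnergySpace.fn_smul_ae c u] with x hx
    rw [hx]; ring
  · intro u v w
    rw [← integral_add (hi u v) (hi u w)]
    refine integral_congr_ae ?_
    filter_upwards [EnergySpace.fn_add_ae v w] with x hx
    rw [hx]; ring
  · intro c u v
    rw [smul_eq_mul, ← integral_const_mul]
    refine integral_congr_ae ?_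
    filter_upwards [EnergySpace.fn_smul_ae c v] with x hx
    rw [hx]; ring
  · intro u v
    obtain ⟨i, l⟩ := hS.linear u v
    refine (norm_integral_le_of_norm_le (i.const_mul m) (Eventually.of_forall fun x => ?_)).trans ?_
    · rw [norm_mul, Real.norm_of_nonneg (negPart_nonneg V x), Real.norm_eq_abs, abs_mul]
      exact mul_le_mul_of_nonneg_right (hm x) (by positivity)
    · rw [integral_const_mul]
      exact (mul_le_mul_of_nonneg_left l hm0).trans_eq (by ring)

lemma exists_gradient_map (hS : IsEmbeddingConst a ha V S) :
    ∃ T : EnergySpace a ha V →L[ℝ] Lp R3 2 (volume : Measure R3), ∀ u, T u = u.grad :=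
  ⟨LinearMap.mkContinuous
    { toFun := fun u : EnergySpace a ha V => u.grad
      map_add' := EnergySpace.grad_add
      map_smul' := EnergySpace.grad_smul } S fun u => (hS.2 u).2.2, fun _ => rfl⟩

/-- With `V = V⁺ - V⁻` the quadratic part becomes `‖u‖²` minus a form with bounded weight, which is
continuous on `E`. -/
lemma functional_eq (hV : CondV1 V) (u : EnergySpace a ha V) :
    functional a ha b V f u = 1 / 2 * ‖u‖ ^ 2 - 1 / 2 * (∫ x, negPart V x * u.fn x ^ 2)
      + b / 4 * (‖u.grad‖ ^ 2) ^ 2 - ∫ x, primitive f x (u.fn x) := by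
  have i : Integrable (fun x => a * ‖u.grad x‖ ^ 2 + posPart V x * u.fn x ^ 2) :=
    ((integrable_grad_sq u.grad).const_mul a).add u.integrable_pot
  rw [functional, L2_norm_sq_eq_integral u.grad, EnergySpace.norm_sq_def, ← mul_sub,
    ← integral_sub i (integrable_negPart_mul hV u.integrable_fn_sq)]
  congr 4
  ext x
  rw [← posPart_sub_negPart V x]
  ring

/-- The functional is continuously differentiable, with the expected derivative. -/
lemma functional_contDiff_and_fderiv (hV : CondV1 V) (hS : IsEmbeddingConst a ha V S)
    (hf1 : CondF1 f p) (hf2 : CondF2 f) (hf4 : CondF4 f) :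
    ContDiff ℝ 1 (functional a ha b V f) ∧ ∀ u v : EnergySpace a ha V,
      fderiv ℝ (functional a ha b V f) u v = inner ℝ u v
        - (∫ x, negPart V x * (u.fn x * v.fn x)) + b * ‖u.grad‖ ^ 2 * inner ℝ u.grad v.grad
        - ∫ x, f x (u.fn x) * v.fn x := by
  obtain ⟨B, hB⟩ := exists_negPart_form hV hS
  obtain ⟨T, hT⟩ := exists_gradient_map hS
  obtain ⟨D, hDc, hD, hDd⟩ := exists_hasFDerivAt_primitive hS hf1 hf2 hf4
  have e : functional a ha b V f = fun u => 1 / 2 * ‖u‖ ^ 2 - 1 / 2 * B u u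
      + b / 4 * (‖T u‖ ^ 2) ^ 2 - ∫ x, primitive f x (u.fn x) := by
    ext u
    rw [functional_eq hV, hB, hT]
    simp only [sq]
  rw [e]
  refine ⟨?_, fun u v => ?_⟩
  · refine ContDiff.sub (ContDiff.add (ContDiff.sub ?_ ?_) ?_) ?_
    · exact contDiff_const.mul (contDiff_norm_sq ℝ)
    · exact contDiff_const.mul (B.contDiff.clm_apply contDiff_id)
    · exact contDiff_const.mul ((T.contDiff.norm_sq ℝ).pow 2)
    · exact contDiff_one_iff_hasFDerivAt.2 ⟨D, hDc, hDd⟩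
  · have h1 := ((hasFDerivAt_id u).norm_sq).const_mul (1 / 2 : ℝ)
    have h2 := ((B.hasFDerivAt (x := u)).clm_apply (hasFDerivAt_id u)).const_mul (1 / 2 : ℝ)
    have h3 := (((T.hasFDerivAt (x := u)).norm_sq).pow 2).const_mul (b / 4)
    have h := ((h1.sub h2).add h3).sub (hDd u)
    have hsymm : B v u = B u v := by
      rw [hB, hB]; simp only [mul_comm (v.fn _)]
    refine (congrArg (fun L : EnergySpace a ha V →L[ℝ] ℝ => L v) h.fderiv).trans ?_
    simp [hsymm, hD, hB, hT]
    ring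

end

/-! ### Cerami sequences: boundedness along a subsequence and convergence. -/

section

lemma IsCeramiSeq.comp {X : Type*} [NormedAddCommGroup X] [NormedSpace ℝ X] {Φ : X → ℝ} {c : ℝ}
    {u : ℕ → X} (h : IsCeramiSeq Φ c u) {k : ℕ → ℕ} (hk : StrictMono k) :
    IsCeramiSeq Φ c (u ∘ k) :=
  ⟨h.1.comp hk.tendsto_atTop, h.2.comp hk.tendsto_atTop⟩

lemma IsCeramiSeq.tendsto_norm_fderiv {X : Type*} [NormedAddCommGroup X] [NormedSpace ℝ X]
    {Φ : X → ℝ} {c : ℝ} {u : ℕ → X} (h : IsCeramiSeq Φ c u) :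
    Tendsto (fun n => ‖fderiv ℝ Φ (u n)‖) atTop (𝓝 0) := by
  refine squeeze_zero (fun n => norm_nonneg _) (fun n => ?_) h.2
  exact le_mul_of_one_le_left (norm_nonneg _) (by linarith [norm_nonneg (u n)])

lemma IsCeramiSeq.tendsto_fderiv_apply_self {X : Type*} [NormedAddCommGroup X] [NormedSpace ℝ X]
    {Φ : X → ℝ} {c : ℝ} {u : ℕ → X} (h : IsCeramiSeq Φ c u) :
    Tendsto (fun n => fderiv ℝ Φ (u n) (u n)) atTop (𝓝 0) := by
  refine squeeze_zero_norm (fun n => ?_) h.2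
  refine (ContinuousLinearMap.le_opNorm _ _).trans ?_
  rw [mul_comm]
  exact mul_le_mul_of_nonneg_right (by linarith) (norm_nonneg _)

lemma exists_subseq_ae_of_tendsto_setIntegral {d : ℕ → R3 → ℝ} {v : R3 → ℝ} {s : Set R3}
    (hd : ∀ n, MemLp (d n) 2 volume) (hv : MemLp v 2 volume)
    (h : Tendsto (fun n => ∫ x in s, (d n x - v x) ^ 2) atTop (𝓝 0)) :
    ∃ k : ℕ → ℕ, StrictMono k ∧
      ∀ᵐ x ∂volume.restrict s, Tendsto (fun n => d (k n) x) atTop (𝓝 (v x)) := by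
  have hsub : ∀ n, MemLp (fun x => d n x - v x) 2 volume := fun n => (hd n).sub hv
  have h1 : Tendsto (fun n => eLpNorm (d n - v) 2 (volume.restrict s)) atTop (𝓝 0) := by
    have h2 := (ENNReal.tendsto_ofReal h)
    have h3 := ((ENNReal.continuous_rpow_const (y := 1 / 2)).tendsto _).comp h2
    rw [ENNReal.ofReal_zero, ENNReal.zero_rpow_of_pos (by norm_num)] at h3
    refine h3.congr fun n => ?_
    rw [Function.comp_apply, setIntegral_sq_eq_toReal_eLpNorm (hsub n).1, ENNReal.ofReal_toReal
      (ENNReal.pow_ne_top ((hsub n).restrict s).2.ne), ← ENNReal.rpow_natCast, ← ENNReal.rpow_mul]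
    norm_num
    rfl
  exact (tendstoInMeasure_of_tendsto_eLpNorm two_ne_zero
    (fun n => ((hd n).restrict s).1) (hv.restrict s).1 h1).exists_seq_tendsto_ae

variable {a b : ℝ} {ha : 0 < a} {V : C(R3, ℝ)} {S : ℝ} {f : R3 → ℝ → ℝ} {p : ℝ}

/-- Rellich's theorem on bounded sets of `E`. The limit is kept as an `L²` function; membership in
`E` is not needed where it is used. -/
lemma exists_subseq_energy_tendsto (hS : IsEmbeddingConst a ha V S)
    {u : ℕ → EnergySpace a ha V} {M : ℝ} (hu : ∀ n, ‖u n‖ ≤ M) :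
    ∃ (v : Lp ℝ 2 (volume : Measure R3)) (k : ℕ → ℕ), StrictMono k ∧ ∀ R,
      Tendsto (fun n => ∫ x in Metric.closedBall 0 R, ((u (k n)).fn x - v x) ^ 2) atTop (𝓝 0) :=
  exists_subseq_tendsto_L2_loc (u := fun n => (u n).fn) (G := fun n => (u n).grad) (C := S * M)
    (fun n => (u n).isWeakGradient)
    (fun n => (hS.2 (u n)).1.trans (mul_le_mul_of_nonneg_left (hu n) hS.1.le))
    (fun n => (hS.2 (u n)).2.2.trans (mul_le_mul_of_nonneg_left (hu n) hS.1.le))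

/-- In `4Φ(u) - Φ'(u)u` the quartic Kirchhoff terms cancel, one copy of the quadratic part survives,
and `4F ≤ tf` gives the remaining integral a sign. -/
lemma norm_sq_sub_le_functional (hV : CondV1 V) (hS : IsEmbeddingConst a ha V S)
    (hf1 : CondF1 f p) (hf2 : CondF2 f) (hf3 : CondF3 f p) (hf4 : CondF4 f)
    (u : EnergySpace a ha V) :
    ‖u‖ ^ 2 - ∫ x, negPart V x * u.fn x ^ 2
      ≤ 4 * functional a ha b V f u - fderiv ℝ (functional a ha b V f) u u := by
  rw [functional_eq hV, (functional_contDiff_and_fderiv hV hS hf1 hf2 hf4).2,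
    real_inner_self_eq_norm_sq, real_inner_self_eq_norm_sq]
  have h1 : 4 * ∫ x, primitive f x (u.fn x) ≤ ∫ x, f x (u.fn x) * u.fn x := by
    rw [← integral_const_mul]
    exact integral_mono ((integrable_primitive hS hf1 hf2 hf4 u).const_mul 4)
      (integrable_nonlinearity_mul hS hf1 hf2 hf4 u u) fun x => hf3.four_primitive_le x _
  simp only [sq (u.fn _)]
  linarith

/-- Solve the formula for `Φ` for `∫F`: the `V⁻` term has a favourable sign, and `‖u‖ ≥ 1` lets
`‖u‖⁴` absorb the lower powers. -/
lemma integral_primitive_le (hV : CondV1 V) (hS : IsEmbeddingConst a ha V S) (hb : 0 < b)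
    (u : EnergySpace a ha V) (hu : 1 ≤ ‖u‖) :
    ∫ x, primitive f x (u.fn x)
      ≤ (1 / 2 + b / 4 * S ^ 4 + |functional a ha b V f u|) * ‖u‖ ^ 4 := by
  have h1 := functional_eq (b := b) (f := f) hV u
  have h2 : 0 ≤ ∫ x, negPart V x * u.fn x ^ 2 :=
    integral_nonneg fun x => mul_nonneg (negPart_nonneg V x) (sq_nonneg _)
  have h3 : (‖u.grad‖ ^ 2) ^ 2 ≤ S ^ 4 * ‖u‖ ^ 4 := by
    rw [← pow_mul, ← mul_pow]
    exact pow_le_pow_left₀ (norm_nonneg _) (hS.2 u).2.2 _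
  have h4 : 1 ≤ ‖u‖ ^ 4 := one_le_pow₀ hu
  have h5 : ‖u‖ ^ 2 ≤ ‖u‖ ^ 4 := pow_le_pow_right₀ hu (by norm_num)
  have h6 : -functional a ha b V f u ≤ |functional a ha b V f u| * ‖u‖ ^ 4 :=
    (neg_le_abs _).trans (le_mul_of_one_le_right (abs_nonneg _) h4)
  have h7 := mul_le_mul_of_nonneg_left h3 (show 0 ≤ b / 4 by positivity)
  linarith

/-- The normalized sequence `‖u‖⁻¹ u` cannot converge to zero in `L²_loc` along an unbounded
Cerami sequence. -/
lemma IsCeramiSeq.not_normalized_tendsto_zero (hV : CondV1 V) (hS : IsEmbeddingConst a ha V S)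
    (hf1 : CondF1 f p) (hf2 : CondF2 f) (hf3 : CondF3 f p) (hf4 : CondF4 f) {c : ℝ}
    {u : ℕ → EnergySpace a ha V} (hu : IsCeramiSeq (functional a ha b V f) c u)
    (hinf : Tendsto (fun n => ‖u n‖) atTop atTop) :
    ¬ ∀ R, Tendsto (fun n => ∫ x in Metric.closedBall 0 R, (‖u n‖⁻¹ • u n).fn x ^ 2)
      atTop (𝓝 0) := by
  intro h0
  -- One quarter comes from the unit norm of the normalized function and, eventually, less than one
  -- quarter from the ball. So `V⁻` consumes at most half of `‖u n‖²`.
  obtain ⟨R, L, hL, hneg⟩ := EnergySpace.exists_integral_negPart_le (ha := ha) hV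
    (show (0 : ℝ) < 1 / 4 by norm_num)
  have hlim := ((hu.1.const_mul 4).sub hu.tendsto_fderiv_apply_self)
  refine not_tendsto_atTop_of_tendsto_nhds hlim ?_
  have hsq : Tendsto (fun n => 1 / 2 * ‖u n‖ ^ 2) atTop atTop :=
    ((tendsto_pow_atTop two_ne_zero).comp hinf).const_mul_atTop (by norm_num)
  refine tendsto_atTop_mono' _ ?_ hsq
  have h1 := (h0 R).const_mul L
  rw [mul_zero] at h1
  filter_upwards [h1.eventually (gt_mem_nhds (show (0 : ℝ) < 1 / 4 by norm_num)),
    hinf.eventually_gt_atTop 0] with n hn hpos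
  refine le_trans ?_ (norm_sq_sub_le_functional hV hS hf1 hf2 hf3 hf4 (u n))
  have h2 := hneg (‖u n‖⁻¹ • u n)
  rw [norm_smul, norm_inv, norm_norm, inv_mul_cancel₀ hpos.ne'] at h2
  have h3 : ∫ x, negPart V x * (‖u n‖⁻¹ • u n).fn x ^ 2
      = (‖u n‖ ^ 2)⁻¹ * ∫ x, negPart V x * (u n).fn x ^ 2 := by
    rw [← integral_const_mul]
    refine integral_congr_ae ?_
    filter_upwards [EnergySpace.fn_smul_ae ‖u n‖⁻¹ (u n)] with x hx
    rw [hx]; ring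
  rw [h3] at h2
  have h4 : (‖u n‖ ^ 2)⁻¹ * ∫ x, negPart V x * (u n).fn x ^ 2 ≤ 1 / 2 := by linarith
  rw [inv_mul_le_iff₀ (by positivity)] at h4
  linarith

/-- The quotient is `F(x, r) / r⁴` times `(ν⁻¹ r)⁴`; the second factor tends to `z⁴ > 0`, and `|r| →
∞`. -/
lemma tendsto_primitive_div (hf2 : CondF2 f) {r ν : ℕ → ℝ} {z : ℝ} (x : R3) (hz : z ≠ 0)
    (hinf : Tendsto ν atTop atTop) (h : Tendsto (fun n => (ν n)⁻¹ * r n) atTop (𝓝 z)) :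
    Tendsto (fun n => primitive f x (r n) / ν n ^ 4) atTop atTop := by
  have hr : Tendsto (fun n => |r n|) atTop atTop := by
    refine (hinf.atTop_mul_pos (abs_pos.2 hz) h.abs).congr' ?_
    filter_upwards [hinf.eventually_gt_atTop 0] with n hn
    rw [abs_mul, abs_inv, abs_of_pos hn, mul_inv_cancel_left₀ hn.ne']
  have hco : Tendsto r atTop (cocompact ℝ) := by
    rw [← Metric.cobounded_eq_cocompact, ← tendsto_norm_atTop_iff_cobounded]
    exact hr
  have h4 : 0 < z ^ 4 := by positivity
  refine (((hf2.2 x).comp hco).atTop_mul_pos h4 (h.pow 4)).congr' ?_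
  filter_upwards [hinf.eventually_gt_atTop 0, hr.eventually_gt_atTop 0] with n hn hrn
  have hrn' : r n ≠ 0 := abs_pos.1 hrn
  simp only [Function.comp_apply]
  field_simp

/-- Dichotomy on the `L²_loc` limit `v` of the normalized sequence. A zero limit is excluded by
`not_normalized_tendsto_zero`; a nonzero one makes `∫F/‖u‖⁴` blow up by Fatou, against
`integral_primitive_le`. -/
lemma IsCeramiSeq.not_tendsto_norm_atTop (hb : 0 < b) (hV : CondV1 V)
    (hS : IsEmbeddingConst a ha V S) (hf1 : CondF1 f p) (hf2 : CondF2 f) (hf3 : CondF3 f p)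
    (hf4 : CondF4 f) {c : ℝ} {u : ℕ → EnergySpace a ha V}
    (hu : IsCeramiSeq (functional a ha b V f) c u) :
    ¬ Tendsto (fun n => ‖u n‖) atTop atTop := by
  intro hinf
  obtain ⟨v, k, hk, hv⟩ := exists_subseq_energy_tendsto hS (u := fun n => ‖u n‖⁻¹ • u n) (M := 1)
    (fun n => by
      rw [norm_smul, norm_inv, norm_norm]
      exact inv_mul_le_one)
  by_cases hv0 : ∀ R : ℕ, ∀ᵐ x ∂volume.restrict (Metric.closedBall (0 : R3) R), v x = 0
  · refine (hu.comp hk).not_normalized_tendsto_zero hV hS hf1 hf2 hf3 hf4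
      (hinf.comp hk.tendsto_atTop) fun R => (hv R).congr fun n => ?_
    obtain ⟨m, hm⟩ := exists_nat_ge R
    refine integral_congr_ae ?_
    filter_upwards [ae_restrict_of_ae_restrict_of_subset
      (Metric.closedBall_subset_closedBall hm) (hv0 m)] with x hx
    rw [hx, sub_zero]; rfl
  · push Not at hv0
    obtain ⟨R, hR⟩ := hv0
    set μ : Measure R3 := volume.restrict (Metric.closedBall (0 : R3) R)
    obtain ⟨l, hl, hae⟩ := exists_subseq_ae_of_tendsto_setIntegral
      (fun n => Lp.memLp (‖u (k n)‖⁻¹ • u (k n)).fn) (Lp.memLp v) (hv R)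
    let w : ℕ → EnergySpace a ha V := fun n => u (k (l n))
    have hw : IsCeramiSeq (functional a ha b V f) c w := hu.comp (hk.comp hl)
    have hwinf : Tendsto (fun n => ‖w n‖) atTop atTop := hinf.comp (hk.comp hl).tendsto_atTop
    let g : ℕ → R3 → ℝ := fun n x => primitive f x ((w n).fn x) / ‖w n‖ ^ 4
    have hg0 : ∀ n x, 0 ≤ g n x := fun n x =>
      div_nonneg (hf3.primitive_nonneg x _) (by positivity)
    have hgi : ∀ n, Integrable (g n) := fun n =>
      (integrable_primitive hS hf1 hf2 hf4 (w n)).div_const _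
    have hgm : ∀ n, Measurable (g n) := fun n => (hf1.continuous_primitive.measurable.comp
      (measurable_id.prodMk (Lp.stronglyMeasurable (w n).fn).measurable)).div_const _
    have hae' : ∀ᵐ x ∂μ, v x ≠ 0 → Tendsto (fun n => ENNReal.ofReal (g n x)) atTop (𝓝 ⊤) := by
      have h1 : ∀ᵐ x ∂μ, ∀ n, (‖w n‖⁻¹ • w n).fn x = ‖w n‖⁻¹ * (w n).fn x :=
        ae_restrict_of_ae (ae_all_iff.2 fun n => EnergySpace.fn_smul_ae _ _)
      filter_upwards [hae, h1] with x hx hx1 hvx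
      refine ENNReal.tendsto_ofReal_atTop.comp (tendsto_primitive_div hf2 x hvx hwinf ?_)
      exact hx.congr fun n => hx1 n
    -- The integrands tend to `⊤` where `v ≠ 0`, a set that is not null in this ball.
    have htop : ∫⁻ x, liminf (fun n => ENNReal.ofReal (g n x)) atTop ∂μ = ⊤ := by
      refine lintegral_eq_top_of_measure_eq_top_ne_zero ?_ ?_
      · exact (Measurable.liminf fun n => (hgm n).ennreal_ofReal).aemeasurable
      · refine fun h => hR ?_
        rw [measure_eq_zero_iff_ae_notMem] at h
        filter_upwards [h, hae'] with x hx hx'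
        by_contra hvx
        exact hx (hx' hvx).liminf_eq
    set K : ℝ := 1 / 2 + b / 4 * S ^ 4 + (|c| + 1)
    have hle : ∀ᶠ n in atTop, ∫⁻ x, ENNReal.ofReal (g n x) ∂μ ≤ ENNReal.ofReal K := by
      filter_upwards [hwinf.eventually_ge_atTop 1,
        hw.1.abs.eventually (gt_mem_nhds (lt_add_one |c|))] with n hn1 hnc
      refine (lintegral_mono' Measure.restrict_le_self le_rfl).trans ?_
      rw [← ofReal_integral_eq_lintegral_ofReal (hgi n) (Eventually.of_forall (hg0 n))]
      refine ENNReal.ofReal_le_ofReal ?_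
      rw [integral_div, div_le_iff₀ (by positivity)]
      refine (integral_primitive_le hV hS hb (w n) hn1).trans ?_
      exact mul_le_mul_of_nonneg_right (add_le_add le_rfl hnc.le) (by positivity)
    have hfatou := lintegral_liminf_le' (μ := μ) (u := atTop)
      (f := fun n x => ENNReal.ofReal (g n x))
      (fun n => (hgm n).ennreal_ofReal.aemeasurable)
    rw [htop, top_le_iff] at hfatou
    have h5 := (liminf_le_liminf hle).trans_eq (liminf_const (ENNReal.ofReal K))
    rw [hfatou, top_le_iff] at h5
    exact ENNReal.ofReal_ne_top h5

/-- By Cauchy–Schwarz the expression is at least `(‖g‖³ - ‖h‖³)(‖g‖ - ‖h‖)`, which is factored in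
`h3`. -/
lemma norm_sq_smul_monotone {H : Type*} [NormedAddCommGroup H] [InnerProductSpace ℝ H] (g h : H) :
    0 ≤ ‖g‖ ^ 2 * inner ℝ g (g - h) - ‖h‖ ^ 2 * inner ℝ h (g - h) := by
  rw [inner_sub_right, inner_sub_right, real_inner_self_eq_norm_sq, real_inner_self_eq_norm_sq,
    real_inner_comm g h]
  have h1 := real_inner_le_norm g h
  have h2 := mul_le_mul_of_nonneg_left h1 (show 0 ≤ ‖g‖ ^ 2 + ‖h‖ ^ 2 by positivity)
  have h3 : 0 ≤ (‖g‖ - ‖h‖) ^ 2 * (‖g‖ ^ 2 + ‖g‖ * ‖h‖ + ‖h‖ ^ 2) := by positivity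
  rw [real_inner_comm] at h2
  nlinarith

/-- On bounded sets the derivative of the functional is strongly monotone modulo `L²_loc`. -/
lemma exists_norm_sub_sq_le (hb : 0 < b) (hV : CondV1 V) (hS : IsEmbeddingConst a ha V S)
    (hf1 : CondF1 f p) (hf2 : CondF2 f) (hf4 : CondF4 f) {M ε : ℝ} (hM : 0 < M) (hε : 0 < ε) :
    ∃ R L : ℝ, 0 ≤ L ∧ ∀ u w : EnergySpace a ha V, ‖u‖ ≤ M → ‖w‖ ≤ M →
      ‖u - w‖ ^ 2 ≤ (‖fderiv ℝ (functional a ha b V f) u‖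
          + ‖fderiv ℝ (functional a ha b V f) w‖) * (2 * M)
        + ε + L * ∫ x in Metric.closedBall 0 R, (u - w).fn x ^ 2 := by
  have hS0 := hS.1
  -- Bounds the growth bracket times `S * ‖d‖` when `‖u‖, ‖w‖ ≤ M` and hence `‖d‖ ≤ 2 * M`. The `V⁻`
  -- and `f` terms each receive an error `ε / 2`.
  set B : ℝ := (S * M + S * M + (S * M) ^ 5 + (S * M) ^ 5) * (S * (2 * M)) with hB
  have hB0 : 0 < B := by positivity
  obtain ⟨R₁, L₁, hL₁, h₁⟩ := EnergySpace.exists_integral_negPart_le (ha := ha) hV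
    (show 0 < ε / (2 * (2 * M) ^ 2) by positivity)
  obtain ⟨R₂, L₂, hL₂, h₂⟩ := exists_nonlinearity_sub_le hS hf1 hf2 hf4
    (show 0 < ε / (2 * B) by positivity)
  refine ⟨max R₁ R₂, L₁ + L₂, by positivity, fun u w hu hw => ?_⟩
  set d := u - w with hd
  have hdM : ‖d‖ ≤ 2 * M := (norm_sub_le u w).trans (by linarith)
  have hmono : ∀ R, R ≤ max R₁ R₂ → ∫ x in Metric.closedBall 0 R, d.fn x ^ 2
      ≤ ∫ x in Metric.closedBall 0 (max R₁ R₂), d.fn x ^ 2 := fun R hR =>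
    setIntegral_mono_set d.integrable_fn_sq.integrableOn
      (Eventually.of_forall fun x => sq_nonneg _)
      (Metric.closedBall_subset_closedBall hR).eventuallyLE
  have hneg : ∫ x, negPart V x * d.fn x ^ 2
      ≤ ε / 2 + L₁ * ∫ x in Metric.closedBall 0 (max R₁ R₂), d.fn x ^ 2 := by
    refine (h₁ d).trans (add_le_add ?_ (mul_le_mul_of_nonneg_left (hmono _ (le_max_left _ _)) hL₁))
    calc ε / (2 * (2 * M) ^ 2) * ‖d‖ ^ 2 ≤ ε / (2 * (2 * M) ^ 2) * (2 * M) ^ 2 := by gcongr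
      _ = ε / 2 := by field_simp
  have hnl : (∫ x, f x (u.fn x) * d.fn x) - ∫ x, f x (w.fn x) * d.fn x
      ≤ ε / 2 + L₂ * ∫ x in Metric.closedBall 0 (max R₁ R₂), d.fn x ^ 2 := by
    refine (le_abs_self _).trans ((h₂ u w d).trans (add_le_add ?_ ?_))
    · calc _ ≤ ε / (2 * B) * B := by rw [hB]; gcongr
        _ = ε / 2 := by field_simp
    · have e : ∀ x, |(u - w).fn x| * |d.fn x| = d.fn x ^ 2 := fun x => by
        rw [← hd, abs_mul_abs_self, sq]
      simp only [e]
      exact mul_le_mul_of_nonneg_left (hmono _ (le_max_right _ _)) hL₂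
  have hder := (functional_contDiff_and_fderiv (b := b) hV hS hf1 hf2 hf4).2
  have hneg_sub : (∫ x, negPart V x * (u.fn x * d.fn x)) - ∫ x, negPart V x * (w.fn x * d.fn x)
      = ∫ x, negPart V x * d.fn x ^ 2 := by
    have hi : ∀ z : EnergySpace a ha V, Integrable (fun x => negPart V x * (z.fn x * d.fn x)) :=
      fun z => integrable_negPart_mul hV (memLp_mul_integrable (Lp.memLp _) (Lp.memLp _))
    rw [← integral_sub (hi u) (hi w)]
    refine integral_congr_ae ?_
    filter_upwards [EnergySpace.fn_sub_ae u w] with x hx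
    rw [← hd] at hx
    rw [hx]; ring
  have hnorm : ‖d‖ ^ 2 = inner ℝ u d - inner ℝ w d := by
    rw [← inner_sub_left, ← hd, real_inner_self_eq_norm_sq]
  -- The Kirchhoff contribution to `(Φ'(u) - Φ'(w))(u - w)` is nonnegative and can be discarded.
  have hkir := mul_nonneg hb.le (norm_sq_smul_monotone u.grad w.grad)
  rw [← EnergySpace.grad_sub, ← hd] at hkir
  have hu1 := (le_abs_self _).trans ((fderiv ℝ (functional a ha b V f) u).le_opNorm d)
  have hw1 := (neg_le_abs _).trans ((fderiv ℝ (functional a ha b V f) w).le_opNorm d)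
  have hu2 := mul_le_mul_of_nonneg_left hdM (norm_nonneg (fderiv ℝ (functional a ha b V f) u))
  have hw2 := mul_le_mul_of_nonneg_left hdM (norm_nonneg (fderiv ℝ (functional a ha b V f) w))
  rw [hder] at hu1 hw1
  linarith

lemma setIntegral_sub_sq_le {u v w : Lp ℝ 2 (volume : Measure R3)} (s : Set R3) :
    ∫ x in s, (u - v : Lp ℝ 2 (volume : Measure R3)) x ^ 2
      ≤ 2 * (∫ x in s, (u x - w x) ^ 2) + 2 * ∫ x in s, (v x - w x) ^ 2 := by
  have hi : ∀ z : Lp ℝ 2 (volume : Measure R3), Integrable (fun x => (z x - w x) ^ 2)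
      (volume.restrict s) := fun z =>
    (((Lp.memLp z).sub (Lp.memLp w)).integrable_sq).restrict
  rw [← integral_const_mul, ← integral_const_mul,
    ← integral_add ((hi u).const_mul 2) ((hi v).const_mul 2)]
  refine integral_mono_ae ((Lp.memLp _).integrable_sq.restrict)
    (((hi u).const_mul 2).add ((hi v).const_mul 2)) ?_
  filter_upwards [ae_restrict_of_ae (Lp.coeFn_sub u v)] with x hx
  simp only [hx, Pi.sub_apply]
  nlinarith [sq_nonneg (u x - w x + (v x - w x))]

theorem ceramiConditionAt_functional (hb : 0 < b) (hV : CondV1 V)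
    (hS : IsEmbeddingConst a ha V S) (hf1 : CondF1 f p) (hf2 : CondF2 f) (hf3 : CondF3 f p)
    (hf4 : CondF4 f) (c : ℝ) : CeramiConditionAt (functional a ha b V f) c := by
  intro u hu
  have hcomplete : CompleteSpace (EnergySpace a ha V) := EnergySpace.completeSpace hV
  -- Norms that do not tend to infinity stay bounded along a subsequence, which suffices here.
  obtain ⟨M, hM⟩ : ∃ M, ∃ᶠ n in atTop, ‖u n‖ ≤ M := by
    by_contra! h
    refine hu.not_tendsto_norm_atTop hb hV hS hf1 hf2 hf3 hf4 (tendsto_atTop.2 fun M => ?_)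
    filter_upwards [h M] with n hn
    exact hn.le
  obtain ⟨k, hk, hkM⟩ := extraction_of_frequently_atTop hM
  have hM1 : ∀ n, ‖u (k n)‖ ≤ |M| + 1 := fun n => (hkM n).trans (by linarith [le_abs_self M])
  have hM0 : 0 < |M| + 1 := by positivity
  obtain ⟨v, l, hl, hv⟩ := exists_subseq_energy_tendsto hS (u := u ∘ k) hM1
  have hw := (hu.comp hk).comp hl
  set w : ℕ → EnergySpace a ha V := fun n => u (k (l n))
  have hcauchy : CauchySeq w := by
    refine Metric.cauchySeq_iff.2 fun δ hδ => ?_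
    -- One third of `δ ^ 2` pays for the error; the other two pay for the indices `m` and `n`
    -- through `hq`.
    obtain ⟨R, L, hL, h⟩ := exists_norm_sub_sq_le hb hV hS hf1 hf2 hf4 hM0
      (show 0 < δ ^ 2 / 3 by positivity)
    have hq : Tendsto (fun n => ‖fderiv ℝ (functional a ha b V f) (w n)‖ * (2 * (|M| + 1))
        + L * (2 * ∫ x in Metric.closedBall 0 R, ((w n).fn x - v x) ^ 2)) atTop (𝓝 0) := by
      simpa using (hw.tendsto_norm_fderiv.mul_const (2 * (|M| + 1))).add
        (((hv R).const_mul 2).const_mul L)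
    obtain ⟨N, hN⟩ := eventually_atTop.1
      (hq.eventually (gt_mem_nhds (show 0 < δ ^ 2 / 3 by positivity)))
    refine ⟨N, fun m hm n hn => ?_⟩
    rw [dist_eq_norm]
    refine lt_of_pow_lt_pow_left₀ 2 hδ.le ((h (w m) (w n) (hM1 _) (hM1 _)).trans_lt ?_)
    have h1 := hN m hm
    have h2 := hN n hn
    have h3 := mul_le_mul_of_nonneg_left (setIntegral_sub_sq_le (u := (w m).fn) (v := (w n).fn)
      (w := v) (Metric.closedBall 0 R)) hL
    rw [← EnergySpace.fn_sub] at h3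
    linarith
  obtain ⟨z, hz⟩ := cauchySeq_tendsto_of_complete hcauchy
  exact ⟨z, k ∘ l, hk.comp hl, hz⟩

end

end Kirchhoff

end

theorem lemma3p3 (a b : ℝ) (ha : 0 < a) (hb : 0 < b)
    (V : C(Kirchhoff.R3, ℝ)) (f : Kirchhoff.R3 → ℝ → ℝ) (p : ℝ)
    (hV1 : Kirchhoff.CondV1 V) (hf1 : Kirchhoff.CondF1 f p) (hf2 : Kirchhoff.CondF2 f)
    (hf3 : Kirchhoff.CondF3 f p) (hf4 : Kirchhoff.CondF4 f) :
    ContDiff ℝ 1 (Kirchhoff.functional a ha b V f) ∧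
      ∀ c : ℝ, Kirchhoff.CeramiConditionAt (Kirchhoff.functional a ha b V f) c := by
  obtain ⟨S, hS⟩ : ∃ S, Kirchhoff.IsEmbeddingConst a ha V S :=
    Kirchhoff.EnergySpace.exists_embedding_const hV1
  exact ⟨(Kirchhoff.functional_contDiff_and_fderiv hV1 hS hf1 hf2 hf4).1,
    Kirchhoff.ceramiConditionAt_functional hb hV1 hS hf1 hf2 hf3 hf4⟩
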